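/- **Theorem.** All logarithms are natural. A *halfspace* on $\mathbb R^M$ is a function $f(x)=1$ if $\langle w,x\rangle\ge 0$ and $f(x)=-1$ otherwise, with $w\in\mathbb R^M$. A distribution $D$ on $\mathbb R^M\times\{-1,1\}$ is a *halfspace with $\eta$-Massart noise* if there are a halfspace $f$, a probability distribution $D_x$ on $\mathbb R^M$ and a measurable function $\eta(\cdot):\mathbb R^M\to[0,\eta]$ (the flipping probability) such that $(x,y)\sim D$ is obtained by drawing $x\sim D_x$ and setting $y=f(x)$ with probability $1-\eta(x)$ and $y=-f(x)$ with probability $\eta(x)$; then $\mathrm{OPT}=\mathbb P_{(x,y)\sim D}[f(x)\ne y]$. An *SQ algorithm* adaptively asks queries $q:\mathbb R^M\times\{-1,1\}\to[-1,1]$ (measurable) and finally outputs a measurable hypothesis $h:\mathbb R^M\to\{-1,1\}$; it may be randomized. The queries have *accuracy* $\tau$ if each query $q$ is answered by an oracle with some real number within $\tau$ of $\mathbb E_{D}[q]$. The algorithm *learns* a class of distributions to misclassification error better than $\varepsilon$ using at most $N$ queries of accuracy $\tau$ if, for every $D$ in the class and every oracle of accuracy $\tau$ for $D$, with probability at least $2/3$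 over its internal randomness it asks at most $N$ queries and outputs $h$ with $\mathbb P_{(x,y)\sim D}[h(x)\neq y]<\varepsilon$. There are universal constants $C,c_1,c_2>0$ such that the following holds. Let $0<\zeta\le\eta\le\frac12$ and let $M\in\mathbb N$ be such that $$l:=\frac{\log M}{(\log\log M)^3\,\log(1/\zeta)}\ \ge\ C .$$ Then there is $\tau$ with $M^{-c_2 l}\le\tau\le M^{-c_1 l}$ such that no SQ algorithm learns halfspaces on $\mathbb R^M$ with $\eta$-Massart noise to misclassification error better than $\eta-\tau$ using at most $1/\tau$ queries of accuracy $\tau$. This holds even for the class restricted to those distributions for which $\mathrm{OPT}\le\zeta$ and every flipping probability is $0$ or $\eta$. -/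

import Mathlib

open MeasureTheory

namespace MassartSQ

/-- The space of examples `ℝ^M`. -/
abbrev Pt (M : ℕ) : Type := EuclideanSpace ℝ (Fin M)

/-- The labels `{-1, 1}`, as the group of units of `ℤ`. -/
abbrev Label : Type := ℤˣ

/-- The halfspace (linear threshold function) with weight vector `w` and threshold `0`. -/
noncomputable def halfspace {M : ℕ} (w : Pt M) (x : Pt M) : Label :=
  if 0 ≤ inner ℝ w x then 1 else -1

/-- The law of `(x, y)`, where `x ∼ Dx` and, given `x`, `y = f x` with probability `1 - flip x`
and `y = -f x` with probability `flip x`. -/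
noncomputable def noisyLaw {M : ℕ} (Dx : Measure (Pt M)) (f : Pt M → Label)
    (flip : Pt M → ℝ) : Measure (Pt M × Label) :=
  (Dx.withDensity fun x => ENNReal.ofReal (1 - flip x)).map (fun x => (x, f x)) +
    (Dx.withDensity fun x => ENNReal.ofReal (flip x)).map (fun x => (x, -f x))

/-- `D` satisfies the `η`-Massart noise condition with respect to the hypothesis `f` and the
marginal distribution `Dx`, with flipping probability function `flip`. -/
structure IsMassart {M : ℕ} (η : ℝ) (D : Measure (Pt M × Label)) (f : Pt M → Label)
    (Dx : Measure (Pt M)) (flip : Pt M → ℝ) : Prop where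
  isProbabilityMeasure : IsProbabilityMeasure Dx
  measurable_flip : Measurable flip
  flip_nonneg : ∀ x, 0 ≤ flip x
  flip_le : ∀ x, flip x ≤ η
  eq_noisyLaw : D = noisyLaw Dx f flip

/-- The misclassification error `P_{(x,y) ∼ D}[h x ≠ y]`. -/
noncomputable def err {M : ℕ} (D : Measure (Pt M × Label)) (h : Pt M → Label) : ℝ :=
  D.real {z | h z.1 ≠ z.2}

/-- The distributions of halfspaces on `ℝ^M` with `η`-Massart noise for which moreover every
flipping probability is `0` or `η` and the halfspace has misclassification error
`OPT = P[f x ≠ y]` at most `ζ`. -/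
def massartHalfspaces (M : ℕ) (η ζ : ℝ) : Set (Measure (Pt M × Label)) :=
  {D | ∃ (w : Pt M) (Dx : Measure (Pt M)) (flip : Pt M → ℝ),
    IsMassart η D (halfspace w) Dx flip ∧ (∀ x, flip x = 0 ∨ flip x = η) ∧
      err D (halfspace w) ≤ ζ}

/-- A statistical query: a measurable function of the labelled example with values in `[-1, 1]`. -/
structure StatQuery (M : ℕ) where
  toFun : Pt M × Label → ℝ
  measurable_toFun : Measurable toFun
  abs_le_one : ∀ z, |toFun z| ≤ 1

/-- A hypothesis: a measurable function from examples to labels, not necessarily a halfspace. -/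
structure Hypothesis (M : ℕ) where
  toFun : Pt M → Label
  measurable_toFun : Measurable toFun

/-- A (deterministic, adaptive) SQ algorithm: it either stops and outputs a hypothesis, or asks a
statistical query and continues depending on the real number received as answer. No bound
on its computational resources other than the number of queries is imposed. -/
inductive SQAlgorithm (M : ℕ) : Type
  | output (h : Hypothesis M) : SQAlgorithm M
  | query (q : StatQuery M) (next : ℝ → SQAlgorithm M) : SQAlgorithm M

/-- The hypothesis output when the queries are answered by `O`. -/
def SQAlgorithm.run {M : ℕ} (O : StatQuery M → ℝ) : SQAlgorithm M → Hypothesis M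
  | .output h => h
  | .query q next => (next (O q)).run O

/-- The number of queries asked when the queries are answered by `O`. -/
def SQAlgorithm.numQueries {M : ℕ} (O : StatQuery M → ℝ) : SQAlgorithm M → ℕ
  | .output _ => 0
  | .query q next => (next (O q)).numQueries O + 1

/-- `O` is a statistical query oracle of accuracy `τ` for the distribution `D`. -/
def IsOracle {M : ℕ} (D : Measure (Pt M × Label)) (τ : ℝ) (O : StatQuery M → ℝ) : Prop :=
  ∀ q : StatQuery M, |O q - ∫ z, q.toFun z ∂D| ≤ τ

/-- The randomized SQ algorithm `alg`, whose internal randomness `ω` has law `P`, learns the class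
`𝒟` to misclassification error better than `ε` using at most `N` queries of accuracy `τ`: for
every distribution in the class and every oracle of accuracy `τ` for it, with probability at least
`2/3` the algorithm asks at most `N` queries and outputs a hypothesis of error less than `ε`.
Deterministic algorithms are the case where `Ω` is a point. The success event itself need not be
measurable, so it is only asked to contain a measurable event of probability at least `2/3`. -/
def Learns {M : ℕ} {Ω : Type*} [MeasurableSpace Ω] (P : Measure Ω) (alg : Ω → SQAlgorithm M)
    (𝒟 : Set (Measure (Pt M × Label))) (N τ ε : ℝ) : Prop :=
  ∀ D ∈ 𝒟, ∀ O : StatQuery M → ℝ, IsOracle D τ O →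
    ∃ S : Set Ω, MeasurableSet S ∧ 2 / 3 ≤ P.real S ∧
      ∀ ω ∈ S, ((alg ω).numQueries O : ℝ) ≤ N ∧ err D ((alg ω).run O).toFun < ε

/-- The quantity `l = log M / ((log log M)^3 log (1/ζ))`. -/
noncomputable def ell (M : ℕ) (ζ : ℝ) : ℝ :=
  Real.log M / (Real.log (Real.log M) ^ 3 * Real.log (1 / ζ))

end MassartSQ

namespace MassartSQ

/-! Hide a vector `v` in `{0,1}^m`. Draw `x` uniformly in `(Fin q)^(2m)` and let `z = hiddenSum v
x`. The label is positive with probability `1 - η`, independently of `x`, and only one further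
coordinate `x₀` betrays it: `x₀ = z % q` for a positive label, while for a negative one `x₀` is
lowered by one if `z % q ≠ 0` and the cell `z / q` lies in a window `W` of likely cells.

Halfspace: `z - x₀` is a multiple of `q` for positive labels and `q * n + 1` with `n ∈ W` for
shifted negative ones. The polynomial in `z - x₀` with roots `q * n + 1/2` and `q * n + 3/2`, `n ∈
W`, separates the two, and it is linear in the monomial coordinates (`inner_sepWeight_monoLift`). An
unshifted seed gives the same point for both labels, so its flipping probability is exactly `η`;
such seeds are rare by Hoeffding (`card_not_shifted_le`), whence `OPT ≤ ζ`.

Hardness: for `u ≠ v` the two values of `x₀` collide with probability at most `1/q + 4/q²`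
(`card_collision_le`). By a second moment argument (`card_mul_le_of_correlated`) a query
distinguishes the law of `v` from the null law, in which `x`, `x₀` and the label are independent,
for at most `8q/τ²` vectors (`card_visible_le`). Under the null law every hypothesis has error at
least `η`. An oracle giving null answers whenever allowed thus defeats `1/τ` queries once `2^m`
exceeds a constant times `q/τ³` (`card_solved_le`, `not_learns_hard`).

Parameters: `q` is of order `τ⁻²`, `m` of order `log (1/τ)`, `|W|` of order `√(m log (1/ζ))`, and
the dimension needed is `(2m+2)^(2|W|) ≤ M`. -/

/-! ### Residues with a label-dependent shift -/

/-- The residue of `z` modulo `q`, lowered by one if it is nonzero and the cell `z / q` belongs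
to the window `W`. -/
def foldRes (q : ℕ) (W : Finset ℕ) (z : ℕ) : ℕ :=
  if z % q ≠ 0 ∧ z / q ∈ W then z % q - 1 else z % q

lemma foldRes_lt {q : ℕ} (hq : 0 < q) (W : Finset ℕ) (z : ℕ) : foldRes q W z < q := by
  have := Nat.mod_lt z hq
  unfold foldRes
  split_ifs <;> omega

lemma foldRes_empty (q z : ℕ) : foldRes q ∅ z = z % q := by simp [foldRes]

lemma mod_of_foldRes {q : ℕ} {W : Finset ℕ} {z β : ℕ} (h : foldRes q W z = β) :
    (z % q = β ∧ (β = 0 ∨ z / q ∉ W)) ∨ (z % q = β + 1 ∧ z / q ∈ W) := by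
  unfold foldRes at h
  split_ifs at h with h1
  · right; exact ⟨by omega, h1.2⟩
  · left; refine ⟨h, ?_⟩
    by_contra! h2
    exact h1 ⟨by omega, h2.2⟩

lemma eq_of_add_mod_eq {q c a b : ℕ} (ha : a < q) (hb : b < q) (h : (c + a) % q = (c + b) % q) :
    a = b := by
  have : a % q = b % q := Nat.ModEq.add_left_cancel' c h
  rwa [Nat.mod_eq_of_lt ha, Nat.mod_eq_of_lt hb] at this

lemma card_foldRes_le_two (q : ℕ) (W : Finset ℕ) (c β : ℕ) :
    ((Finset.range q).filter fun a => foldRes q W (c + a) = β).card ≤ 2 := by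
  have : ((Finset.range q).filter fun a => foldRes q W (c + a) = β).card
      ≤ ({β, β + 1} : Finset ℕ).card := by
    apply Finset.card_le_card_of_injOn (fun a => (c + a) % q)
    · intro a ha
      simp only [Finset.coe_filter, Finset.mem_range, Set.mem_ofPred_eq] at ha
      rcases mod_of_foldRes ha.2 with h | h <;> simp [h.1]
    · intro a ha b hb hab
      simp only [Finset.coe_filter, Finset.mem_range, Set.mem_ofPred_eq] at ha hb
      exact eq_of_add_mod_eq ha.1 hb.1 hab
  exact this.trans Finset.card_le_two

/-- Over a full period the residues `β` and `β + 1` occur at consecutive values of `c + a`, hence in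
the same cell, unless the period starts at residue `β + 1`. Within one cell the shift applies to
both or to neither. Residue `0` is never shifted, so `β = 0` must be excluded. -/
lemma foldRes_injOn {q : ℕ} {W : Finset ℕ} {c β : ℕ} (h0 : β ≠ 0) (h1 : β + 1 ≠ c % q) {a b : ℕ}
    (ha : a < q) (hb : b < q) (hga : foldRes q W (c + a) = β) (hgb : foldRes q W (c + b) = β) :
    a = b := by
  have key : ∀ a b : ℕ, a < q → b < q → (c + a) % q = β → (c + a) / q ∉ W →
      (c + b) % q = β + 1 → (c + b) / q ∈ W → False := by
    intro a b ha hb har haW hbr hbW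
    have hne : (c + a) / q ≠ (c + b) / q := fun h => haW (h ▸ hbW)
    have ea := Nat.div_add_mod (c + a) q
    have eb := Nat.div_add_mod (c + b) q
    rw [har] at ea
    rw [hbr] at eb
    rcases lt_or_gt_of_ne hne with h | h
    · have : q * ((c + a) / q + 1) ≤ q * ((c + b) / q) := Nat.mul_le_mul_left q h
      rw [mul_add] at this
      omega
    · have : q * ((c + b) / q + 1) ≤ q * ((c + a) / q) := Nat.mul_le_mul_left q h
      rw [mul_add] at this
      have hb0 : b = 0 := by omega
      subst hb0
      exact h1 (by simpa using hbr.symm)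
  rcases mod_of_foldRes hga with ⟨h, h'⟩ | ⟨h, h'⟩ <;>
    rcases mod_of_foldRes hgb with ⟨k, k'⟩ | ⟨k, k'⟩
  · exact eq_of_add_mod_eq ha hb (h.trans k.symm)
  · exact (key a b ha hb h (h'.resolve_left h0) k k').elim
  · exact (key b a hb ha k (k'.resolve_left h0) h h').elim
  · exact eq_of_add_mod_eq ha hb (h.trans k.symm)

lemma card_foldRes_eq_le (q : ℕ) (W : Finset ℕ) (c β : ℕ) :
    ((Finset.range q).filter fun a => foldRes q W (c + a) = β).card
      ≤ 1 + (if β = 0 then 1 else 0) + (if β + 1 = c % q then 1 else 0) := by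
  have h2 := card_foldRes_le_two q W c β
  split_ifs with h0 h1 h1
  · omega
  · omega
  · omega
  · rw [Finset.card_le_one]
    intro a ha b hb
    simp only [Finset.mem_filter, Finset.mem_range] at ha hb
    exact foldRes_injOn h0 h1 ha.1 hb.1 ha.2 hb.2

/-- Two shifted residues collide with probability at most `1 / q + 4 / q ^ 2`. -/
lemma sum_foldRes_collision_le (q : ℕ) (W : Finset ℕ) (c d : ℕ) :
    ∑ b ∈ Finset.range q, ∑ a ∈ Finset.range q,
      (if foldRes q W (c + a) = foldRes q W (d + b) then 1 else 0) ≤ q + 4 := by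
  -- Each of the two exceptional values of `β` is attained by at most two `b`; this is the `4`.
  calc _ ≤ ∑ b ∈ Finset.range q, (1 + (if foldRes q W (d + b) = 0 then 1 else 0) +
        (if foldRes q W (d + b) + 1 = c % q then 1 else 0)) := by
        apply Finset.sum_le_sum
        intro b _
        rw [← Finset.card_filter]
        exact card_foldRes_eq_le q W c _
    _ ≤ q + 4 := by
        rw [Finset.sum_add_distrib, Finset.sum_add_distrib, ← Finset.card_filter,
          ← Finset.card_filter]
        have h1 := card_foldRes_le_two q W d 0
        have h2 := card_foldRes_le_two q W d (c % q - 1)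
        have h3 : ((Finset.range q).filter fun b => foldRes q W (d + b) + 1 = c % q).card ≤
            ((Finset.range q).filter fun b => foldRes q W (d + b) = c % q - 1).card := by
          apply Finset.card_le_card
          apply Finset.monotone_filter_right
          intro b _ h
          show foldRes q W (d + b) = c % q - 1
          have h : foldRes q W (d + b) + 1 = c % q := h
          omega
        simp only [Finset.sum_const, Finset.card_range, smul_eq_mul, mul_one]
        omega

/-! ### Resampling a coordinate -/

/-- Exchanging a coordinate of a function with a given value. -/
def swapCoord {ι α : Type*} [DecidableEq ι] (i : ι) : ((ι → α) × α) ≃ ((ι → α) × α) where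
  toFun p := (Function.update p.1 i p.2, p.1 i)
  invFun p := (Function.update p.1 i p.2, p.1 i)
  left_inv p := by simp
  right_inv p := by simp

/-- Replacing a coordinate by a fresh uniform value preserves the uniform law; `swapCoord` is the
bijection behind this. -/
lemma sum_update {ι α R : Type*} [DecidableEq ι] [Fintype ι] [Fintype α] [CommSemiring R]
    (i : ι) (F : (ι → α) → R) :
    ∑ x, ∑ a, F (Function.update x i a) = Fintype.card α * ∑ x, F x := by
  classical
  have h := (swapCoord i).sum_comp (fun p : (ι → α) × α => F p.1)
  rw [Fintype.sum_prod_type, Fintype.sum_prod_type] at h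
  simp only [swapCoord, Equiv.coe_fn_mk] at h
  rw [h, Finset.mul_sum]
  simp

/-! ### The hidden sum -/

/-- The sum of the coordinates selected by the hidden vector `v`. -/
def hiddenSum {m q : ℕ} (v : Fin m → Bool) (x : Fin m × Bool → Fin q) : ℕ :=
  ∑ i, (x (i, v i) : ℕ)

lemma hiddenSum_update_self {m q : ℕ} (v : Fin m → Bool) (x : Fin m × Bool → Fin q) (i : Fin m)
    (a : Fin q) : hiddenSum v (Function.update x (i, v i) a) =
      (∑ j ∈ Finset.univ.erase i, (x (j, v j) : ℕ)) + a := by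
  unfold hiddenSum
  rw [← Finset.sum_erase_add _ _ (Finset.mem_univ i)]
  congr 1
  · apply Finset.sum_congr rfl
    intro j hj
    rw [Function.update_of_ne]
    intro h
    exact Finset.ne_of_mem_erase hj (congrArg Prod.fst h)
  · simp

lemma hiddenSum_update_of_ne {m q : ℕ} (v : Fin m → Bool) (x : Fin m × Bool → Fin q) {i : Fin m}
    {b : Bool} (hb : b ≠ v i) (a : Fin q) :
    hiddenSum v (Function.update x (i, b) a) = hiddenSum v x := by
  unfold hiddenSum
  apply Finset.sum_congr rfl
  intro j _
  rw [Function.update_of_ne]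
  intro h
  simp only [Prod.mk.injEq] at h
  obtain ⟨rfl, h2⟩ := h
  exact hb h2.symm

/-- Where `u` and `v` differ, `(i, u i)` enters only the sum of `u` and `(i, v i)` only that of `v`.
Resampling both with all else frozen reduces to `sum_foldRes_collision_le`. -/
lemma card_collision_le {m q : ℕ} (W : Finset ℕ) {u v : Fin m → Bool} (huv : u ≠ v) :
    q * (q * (Finset.univ.filter fun x : Fin m × Bool → Fin q =>
      foldRes q W (hiddenSum u x) = foldRes q W (hiddenSum v x)).card) ≤
      (q + 4) * Fintype.card (Fin m × Bool → Fin q) := by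
  obtain ⟨i, hi⟩ := Function.ne_iff.mp huv
  let F : (Fin m × Bool → Fin q) → ℕ := fun x =>
    if foldRes q W (hiddenSum u x) = foldRes q W (hiddenSum v x) then 1 else 0
  have h1 := sum_update (R := ℕ) (i, u i) F
  have h2 := sum_update (R := ℕ) (i, v i) (fun x => ∑ a, F (Function.update x (i, u i) a))
  simp only [Fintype.card_fin, Nat.cast_id] at h1 h2
  rw [Finset.card_filter, ← h1, ← h2, mul_comm, ← smul_eq_mul, ← Finset.card_univ]
  apply Finset.sum_le_card_nsmul
  intro x _
  have e : ∀ a b : Fin q, F (Function.update (Function.update x (i, v i) b) (i, u i) a) =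
      if foldRes q W ((∑ j ∈ Finset.univ.erase i, (x (j, u j) : ℕ)) + a) =
        foldRes q W ((∑ j ∈ Finset.univ.erase i, (x (j, v j) : ℕ)) + b) then 1 else 0 := by
    intro a b
    have hne : ((i, u i) : Fin m × Bool) ≠ (i, v i) := by simp [hi]
    have e1 : hiddenSum u (Function.update (Function.update x (i, v i) b) (i, u i) a) =
        (∑ j ∈ Finset.univ.erase i, (x (j, u j) : ℕ)) + a := by
      rw [Function.update_comm hne.symm, hiddenSum_update_of_ne u _ (Ne.symm hi),
        hiddenSum_update_self]
    have e2 : hiddenSum v (Function.update (Function.update x (i, v i) b) (i, u i) a) =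
        (∑ j ∈ Finset.univ.erase i, (x (j, v j) : ℕ)) + b := by
      rw [hiddenSum_update_of_ne v _ hi, hiddenSum_update_self]
    show (if _ then 1 else 0) = _
    rw [e1, e2]
  simp only [e]
  have := sum_foldRes_collision_le q W (∑ j ∈ Finset.univ.erase i, (x (j, u j) : ℕ))
    (∑ j ∈ Finset.univ.erase i, (x (j, v j) : ℕ))
  simpa only [Finset.sum_range] using this

lemma card_hiddenSum_mod_eq_zero_le {m q : ℕ} (v : Fin m → Bool) (i : Fin m) :
    q * (Finset.univ.filter fun x : Fin m × Bool → Fin q => hiddenSum v x % q = 0).card ≤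
      Fintype.card (Fin m × Bool → Fin q) := by
  have h1 := sum_update (R := ℕ) (i, v i) (fun x : Fin m × Bool → Fin q =>
    if hiddenSum v x % q = 0 then 1 else 0)
  simp only [Fintype.card_fin, Nat.cast_id] at h1
  rw [Finset.card_filter, ← h1, ← Finset.card_univ, Finset.card_eq_sum_ones]
  apply Finset.sum_le_sum
  intro x _
  rw [← Finset.card_filter, Finset.card_le_one]
  intro a ha b hb
  simp only [Finset.mem_filter, Finset.mem_univ, true_and, hiddenSum_update_self] at ha hb
  exact Fin.ext (eq_of_add_mod_eq a.2 b.2 (ha.trans hb.symm))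

/-! ### Few hidden vectors are visible to a given test function -/

/-- If the maps `φ v` are almost pairwise independent, then the average of a bounded function
along `φ v` exceeds its mean by `τ` for few `v` only. -/
lemma card_mul_le_of_correlated {V X Z : Type*} [Fintype X] [Fintype Z] [DecidableEq Z]
    [Nonempty X] (φ : V → X → Z) (S : Finset V) (κ : ℝ)
    (hφ : ∀ u v, u ≠ v → (Fintype.card Z : ℝ) * (Fintype.card Z *
      (Finset.univ.filter fun x => φ u x = φ v x).card) ≤
        (Fintype.card Z + κ) * Fintype.card X)
    (hκ : 0 ≤ κ) (hZ : 0 < Fintype.card Z)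
    (h : X → Z → ℝ) (hh : ∀ x z, |h x z| ≤ 1) {τ : ℝ} (hτ : 0 ≤ τ)
    (hS : ∀ v ∈ S, τ * Fintype.card X ≤
      ∑ x, h x (φ v x) - (∑ x, ∑ z, h x z) / Fintype.card Z) :
    S.card * (τ ^ 2 - κ / Fintype.card Z) ≤ Fintype.card Z := by
  classical
  set q : ℝ := (Fintype.card Z : ℝ) with hq
  set N : ℝ := (Fintype.card X : ℝ) with hN
  have hq0 : 0 < q := by rw [hq]; exact_mod_cast hZ
  have hN0 : 0 < N := by rw [hN]; exact_mod_cast Fintype.card_pos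
  -- The total correlation over `S` is the pairing of `h` with the deviation `cnt - s / q`.
  -- Cauchy–Schwarz bounds it by the second moment of `cnt`, which counts collisions.
  set cnt : X → Z → ℝ := fun x z => ∑ v ∈ S, if φ v x = z then (1 : ℝ) else 0 with hcnt
  set s : ℝ := (S.card : ℝ) with hs
  have hcs : ∀ x, ∑ z, cnt x z = s := by
    intro x
    simp only [hcnt]
    rw [Finset.sum_comm]
    simp [hs]
  have h1 : s * (τ * N) ≤ ∑ x, ∑ z, h x z * (cnt x z - s / q) := by
    have e : ∑ x, ∑ z, h x z * (cnt x z - s / q) =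
        ∑ v ∈ S, (∑ x, h x (φ v x) - (∑ x, ∑ z, h x z) / q) := by
      have e1 : ∑ x, ∑ z, h x z * cnt x z = ∑ v ∈ S, ∑ x, h x (φ v x) := by
        rw [Finset.sum_comm (s := S)]
        apply Finset.sum_congr rfl
        intro x _
        simp only [hcnt, Finset.mul_sum]
        rw [Finset.sum_comm]
        simp
      simp only [mul_sub, Finset.sum_sub_distrib, e1, ← Finset.sum_mul, Finset.sum_const,
        nsmul_eq_mul]
      ring
    rw [e]
    have := Finset.card_nsmul_le_sum S _ _ hS
    simpa [nsmul_eq_mul] using this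
  have h2 : (∑ x, ∑ z, h x z * (cnt x z - s / q)) ^ 2 ≤
      (N * q) * ∑ x, ∑ z, (cnt x z - s / q) ^ 2 := by
    rw [← Fintype.sum_prod_type' (fun x z => h x z * (cnt x z - s / q)),
      ← Fintype.sum_prod_type' (fun x z => (cnt x z - s / q) ^ 2)]
    refine (Finset.sum_mul_sq_le_sq_mul_sq _ _ _).trans ?_
    apply mul_le_mul_of_nonneg_right _ (Finset.sum_nonneg fun _ _ => sq_nonneg _)
    have : ∀ p ∈ (Finset.univ : Finset (X × Z)), h p.1 p.2 ^ 2 ≤ 1 := by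
      intro p _
      rw [sq_le_one_iff_abs_le_one]
      exact hh _ _
    refine (Finset.sum_le_card_nsmul _ _ _ this).trans ?_
    simp [hq, hN, Fintype.card_prod]
  have h3 : ∑ x, ∑ z, (cnt x z - s / q) ^ 2 =
      (∑ u ∈ S, ∑ v ∈ S, ((Finset.univ.filter fun x => φ u x = φ v x).card : ℝ)) - N * s ^ 2 / q := by
    have e1 : ∀ x, ∑ z, (cnt x z - s / q) ^ 2 =
        (∑ u ∈ S, ∑ v ∈ S, if φ u x = φ v x then (1 : ℝ) else 0) - s ^ 2 / q := by
      intro x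
      have e2 : ∑ z, cnt x z ^ 2 = ∑ u ∈ S, ∑ v ∈ S, if φ u x = φ v x then (1 : ℝ) else 0 := by
        simp only [hcnt, sq, Finset.sum_mul_sum]
        rw [Finset.sum_comm]
        apply Finset.sum_congr rfl
        intro u _
        rw [Finset.sum_comm]
        apply Finset.sum_congr rfl
        intro v _
        simp [eq_comm]
      have e3 : ∑ z, (cnt x z - s / q) ^ 2 =
          ∑ z, cnt x z ^ 2 - 2 * (s / q) * ∑ z, cnt x z + q * (s / q) ^ 2 := by
        simp only [sub_sq, Finset.sum_add_distrib, Finset.sum_sub_distrib, Finset.sum_const,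
          Finset.mul_sum, Finset.card_univ, nsmul_eq_mul, hq]
        congr 2
        apply Finset.sum_congr rfl
        intro z _
        ring
      rw [e3, hcs, e2]
      field_simp
      ring
    simp only [e1, Finset.sum_sub_distrib, Finset.sum_const, Finset.card_univ, nsmul_eq_mul]
    rw [Finset.sum_comm, ← hN, mul_div_assoc]
    congr 1
    apply Finset.sum_congr rfl
    intro u _
    rw [Finset.sum_comm]
    apply Finset.sum_congr rfl
    intro v _
    simp
  -- Diagonal pairs contribute `N` each. The main part `N * s ^ 2 / q` of the other pairs cancels
  -- the term subtracted in `h3`, leaving only the `κ` part.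
  have h4 : ∑ u ∈ S, ∑ v ∈ S, ((Finset.univ.filter fun x => φ u x = φ v x).card : ℝ) ≤
      s * N + s ^ 2 * ((q + κ) * N / q ^ 2) := by
    have b : ∀ u v, ((Finset.univ.filter fun x => φ u x = φ v x).card : ℝ) ≤
        (if u = v then N else 0) + (q + κ) * N / q ^ 2 := by
      intro u v
      split_ifs with huv
      · have : ((Finset.univ.filter fun x => φ u x = φ v x).card : ℝ) ≤ N := by
          rw [hN]; exact_mod_cast Finset.card_le_univ _
        have : 0 ≤ (q + κ) * N / q ^ 2 := by positivity
        linarith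
      · rw [zero_add, le_div_iff₀ (by positivity)]
        have := hφ u v huv
        nlinarith
    calc _ ≤ ∑ u ∈ S, ∑ v ∈ S, ((if u = v then N else 0) + (q + κ) * N / q ^ 2) :=
          Finset.sum_le_sum fun u _ => Finset.sum_le_sum fun v _ => b u v
      _ = _ := by
          simp only [Finset.sum_add_distrib, Finset.sum_const, nsmul_eq_mul,
            Finset.sum_ite_eq]
          rw [Finset.sum_ite_mem]
          simp [hs]
          ring
  have h5 : (s * (τ * N)) ^ 2 ≤ (N * q) * (s * N + s ^ 2 * (κ * N / q ^ 2)) := by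
    have hs0 : 0 ≤ s := by rw [hs]; positivity
    calc (s * (τ * N)) ^ 2 ≤ (∑ x, ∑ z, h x z * (cnt x z - s / q)) ^ 2 :=
          pow_le_pow_left₀ (by positivity) h1 2
      _ ≤ _ := h2
      _ ≤ _ := by
          apply mul_le_mul_of_nonneg_left _ (by positivity)
          rw [h3]
          have : s ^ 2 * ((q + κ) * N / q ^ 2) = N * s ^ 2 / q + s ^ 2 * (κ * N / q ^ 2) := by
            field_simp
          linarith
  rcases S.eq_empty_or_nonempty with hE | hE
  · simp [hs, hE, hq0.le]
  have hs0 : 0 < s := by rw [hs]; exact_mod_cast hE.card_pos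
  have e6 : (N * q) * (s * N + s ^ 2 * (κ * N / q ^ 2)) = (s * N ^ 2) * (q + s * (κ / q)) := by
    field_simp
  have e7 : (s * (τ * N)) ^ 2 = (s * N ^ 2) * (s * τ ^ 2) := by ring
  rw [e6, e7] at h5
  have := le_of_mul_le_mul_left h5 (by positivity)
  linarith

/-! ### A Hoeffding bound for the hidden sum -/

/-- The reflection `k ↦ q - 1 - k` turns `exp` into `cosh`, and `cosh y ≤ exp (y ^ 2 / 2)` with `|k
- (q - 1) / 2| ≤ q / 2`. -/
lemma sum_exp_centered_le (q : ℕ) (s : ℝ) :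
    ∑ k : Fin q, Real.exp (s * ((k : ℝ) - (q - 1) / 2)) ≤
      q * Real.exp (s ^ 2 * q ^ 2 / 8) := by
  have hrev : ∑ k : Fin q, Real.exp (s * ((k : ℝ) - (q - 1) / 2)) =
      ∑ k : Fin q, Real.exp (-(s * ((k : ℝ) - (q - 1) / 2))) := by
    rw [← Equiv.sum_comp Fin.revPerm]
    apply Finset.sum_congr rfl
    intro k _
    congr 1
    have : ((Fin.rev k : Fin q) : ℝ) = q - 1 - k := by
      rw [Fin.val_rev, Nat.cast_sub (by omega)]
      push_cast
      ring
    rw [Fin.revPerm_apply, this]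
    ring
  have hc : ∑ k : Fin q, Real.exp (s * ((k : ℝ) - (q - 1) / 2)) =
      ∑ k : Fin q, Real.cosh (s * ((k : ℝ) - (q - 1) / 2)) := by
    simp only [Real.cosh_eq]
    rw [← Finset.sum_div, Finset.sum_add_distrib, ← hrev]
    ring
  rw [hc]
  have : ∀ k ∈ (Finset.univ : Finset (Fin q)),
      Real.cosh (s * ((k : ℝ) - (q - 1) / 2)) ≤ Real.exp (s ^ 2 * q ^ 2 / 8) := by
    intro k _
    refine (Real.cosh_le_exp_half_sq _).trans (Real.exp_le_exp.mpr ?_)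
    have hk : (k : ℝ) + 1 ≤ q := by exact_mod_cast k.2
    have hk0 : (0 : ℝ) ≤ k := by positivity
    have : ((k : ℝ) - (q - 1) / 2) ^ 2 ≤ (q / 2) ^ 2 := by
      apply sq_le_sq'
      · linarith
      · linarith
    have := mul_le_mul_of_nonneg_left this (sq_nonneg s)
    rw [mul_pow]
    linarith
  refine (Finset.sum_le_card_nsmul _ _ _ this).trans ?_
  simp

/-- The exponential factors over the `2m` independent coordinates; those not selected by `v`
contribute a bare `q`. -/
lemma sum_exp_hiddenSum_le {m q : ℕ} (v : Fin m → Bool) (s : ℝ) :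
    ∑ x : Fin m × Bool → Fin q, Real.exp (s * ((hiddenSum v x : ℝ) - m * ((q - 1) / 2))) ≤
      Fintype.card (Fin m × Bool → Fin q) * Real.exp (m * (s ^ 2 * q ^ 2 / 8)) := by
  have e : ∀ x : Fin m × Bool → Fin q,
      Real.exp (s * ((hiddenSum v x : ℝ) - m * ((q - 1) / 2))) =
        ∏ p : Fin m × Bool, if p.2 = v p.1 then
          Real.exp (s * ((x p : ℝ) - (q - 1) / 2)) else 1 := by
    intro x
    rw [Fintype.prod_prod_type]
    simp only [Fintype.prod_bool]
    have : ∀ i : Fin m, ((if true = v i then Real.exp (s * ((x (i, true) : ℝ) - (q - 1) / 2)) else 1)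
        * if false = v i then Real.exp (s * ((x (i, false) : ℝ) - (q - 1) / 2)) else 1) =
        Real.exp (s * ((x (i, v i) : ℝ) - (q - 1) / 2)) := by
      intro i
      cases v i <;> simp
    simp only [this]
    rw [← Real.exp_sum, ← Finset.mul_sum, Finset.sum_sub_distrib]
    simp [hiddenSum]
  simp only [e]
  have := Finset.prod_univ_sum (fun _ : Fin m × Bool => (Finset.univ : Finset (Fin q)))
    (fun p k => if p.2 = v p.1 then Real.exp (s * ((k : ℝ) - (q - 1) / 2)) else 1)
  rw [Fintype.piFinset_univ] at this
  rw [← this, Fintype.prod_prod_type]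
  have b : ∀ i : Fin m, (∏ b : Bool, ∑ k : Fin q, if b = v i then
      Real.exp (s * ((k : ℝ) - (q - 1) / 2)) else 1) ≤
        (q : ℝ) ^ 2 * Real.exp (s ^ 2 * q ^ 2 / 8) := by
    intro i
    have := mul_le_mul_of_nonneg_left (sum_exp_centered_le q s) (Nat.cast_nonneg q)
    cases v i <;> simp <;> nlinarith
  refine (Finset.prod_le_prod (fun i _ => Finset.prod_nonneg fun b _ => Finset.sum_nonneg
    fun k _ => by split_ifs <;> positivity) (fun i _ => b i)).trans ?_
  simp only [Finset.prod_const, Finset.card_univ, Fintype.card_fin, Fintype.card_pi,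
    Fintype.card_prod, Fintype.card_bool, mul_pow, ← Real.exp_nat_mul]
  push_cast
  rw [← pow_mul, mul_comm 2 m]

lemma card_hiddenSum_far_le {m q : ℕ} (hq : 0 < q) (hm : 0 < m) (v : Fin m → Bool) {r : ℝ}
    (hr : 0 ≤ r) :
    ((Finset.univ.filter fun x : Fin m × Bool → Fin q =>
      r * q ≤ |(hiddenSum v x : ℝ) - m * ((q - 1) / 2)|).card : ℝ) ≤
      2 * Real.exp (-(2 * r ^ 2 / m)) * Fintype.card (Fin m × Bool → Fin q) := by
  set N : ℝ := (Fintype.card (Fin m × Bool → Fin q) : ℝ) with hN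
  set Y : (Fin m × Bool → Fin q) → ℝ := fun x => (hiddenSum v x : ℝ) - m * ((q - 1) / 2) with hY
  have hq' : (0 : ℝ) < q := by exact_mod_cast hq
  have hm' : (0 : ℝ) < m := by exact_mod_cast hm
  -- The minimiser of the exponent `m * s ^ 2 * q ^ 2 / 8 - s * r * q`.
  set s : ℝ := 4 * r / (m * q) with hs
  have hs0 : 0 ≤ s := by positivity
  have h1 := sum_exp_hiddenSum_le (q := q) v s
  have h2 := sum_exp_hiddenSum_le (q := q) v (-s)
  have h3 : ((Finset.univ.filter fun x => r * q ≤ |Y x|).card : ℝ) * Real.exp (s * (r * q)) ≤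
      ∑ x, (Real.exp (s * Y x) + Real.exp (-s * Y x)) := by
    rw [Finset.card_filter, Nat.cast_sum, Finset.sum_mul]
    apply Finset.sum_le_sum
    intro x _
    split_ifs with hx
    · rw [Nat.cast_one, one_mul]
      rcases le_abs'.mp hx with h | h
      · have : s * (r * q) ≤ -s * Y x := by nlinarith
        have := Real.exp_le_exp.mpr this
        linarith [Real.exp_pos (s * Y x)]
      · have : s * (r * q) ≤ s * Y x := by nlinarith
        have := Real.exp_le_exp.mpr this
        linarith [Real.exp_pos (-s * Y x)]
    · simp only [Nat.cast_zero, zero_mul]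
      positivity
  rw [Finset.sum_add_distrib] at h3
  rw [neg_sq] at h2
  have e1 : (m : ℝ) * (s ^ 2 * q ^ 2 / 8) = 2 * r ^ 2 / m := by
    rw [hs]; field_simp; ring
  have e2 : s * (r * q) = 2 * r ^ 2 / m + 2 * r ^ 2 / m := by
    rw [hs]; field_simp; ring
  rw [e1] at h1 h2
  rw [e2, Real.exp_add] at h3
  have h4 : ((Finset.univ.filter fun x => r * q ≤ |Y x|).card : ℝ) * Real.exp (2 * r ^ 2 / m) ≤
      2 * N := by
    have hpos := Real.exp_pos (2 * r ^ 2 / m)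
    apply le_of_mul_le_mul_right _ hpos
    linarith
  rw [Real.exp_neg]
  have hpos := Real.exp_pos (2 * r ^ 2 / m)
  rw [← le_div_iff₀ hpos] at h4
  refine h4.trans (le_of_eq ?_)
  field_simp

/-! ### Finitely supported laws -/

/-- The measure with mass `a i` at the point `p i`. -/
noncomputable def finLaw {α I : Type*} [MeasurableSpace α] [Fintype I] (a : I → ℝ) (p : I → α) :
    Measure α :=
  ∑ i, ENNReal.ofReal (a i) • Measure.dirac (p i)

section finLaw

variable {α I : Type*} [MeasurableSpace α] [Fintype I]

lemma integral_finLaw {a : I → ℝ} (ha : ∀ i, 0 ≤ a i) (p : I → α) {h : α → ℝ}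
    (hh : Measurable h) : ∫ z, h z ∂(finLaw a p) = ∑ i, a i * h (p i) := by
  unfold finLaw
  rw [integral_finsetSum_measure]
  · apply Finset.sum_congr rfl
    intro i _
    rw [integral_smul_measure, integral_dirac' _ _ hh.stronglyMeasurable,
      ENNReal.toReal_ofReal (ha i), smul_eq_mul]
  · intro i _
    exact (integrable_dirac' hh.stronglyMeasurable (by simp)).smul_measure ENNReal.ofReal_ne_top

lemma real_finLaw {a : I → ℝ} (ha : ∀ i, 0 ≤ a i) (p : I → α) {A : Set α}
    (hA : MeasurableSet A) : (finLaw a p).real A = ∑ i, a i * A.indicator 1 (p i) := by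
  rw [← integral_finLaw ha p (measurable_one.indicator hA), integral_indicator_one hA]

lemma isProbabilityMeasure_finLaw {a : I → ℝ} (ha : ∀ i, 0 ≤ a i) (p : I → α)
    (h1 : ∑ i, a i = 1) : IsProbabilityMeasure (finLaw a p) := by
  constructor
  unfold finLaw
  rw [Measure.finsetSum_apply]
  simp only [Measure.smul_apply, measure_univ, smul_eq_mul, mul_one]
  rw [← ENNReal.ofReal_sum_of_nonneg fun i _ => ha i, h1, ENNReal.ofReal_one]

lemma lintegral_finLaw (a : I → ℝ) (p : I → α) {h : α → ENNReal} (hh : Measurable h) :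
    ∫⁻ z, h z ∂(finLaw a p) = ∑ i, ENNReal.ofReal (a i) * h (p i) := by
  unfold finLaw
  rw [lintegral_finsetSum_measure]
  apply Finset.sum_congr rfl
  intro i _
  rw [lintegral_smul_measure, lintegral_dirac' _ hh, smul_eq_mul]

end finLaw

/-! ### Measurability of halfspaces, and noise over a finitely supported marginal. -/

instance : MeasurableSingletonClass Label where
  measurableSet_singleton u := by
    refine ⟨{(u : ℤ)}, measurableSet_singleton _, ?_⟩
    ext y
    simp [Units.val_inj]

lemma measurable_halfspace {M : ℕ} (w : Pt M) : Measurable (halfspace w) := by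
  unfold halfspace
  apply Measurable.ite _ measurable_const measurable_const
  exact measurableSet_le measurable_const (by fun_prop)

lemma withDensity_map_finLaw_apply {M : ℕ} {I : Type*} [Fintype I] (a : I → ℝ) (p : I → Pt M)
    {ψ : Pt M → Label} (hψ : Measurable ψ) {d : Pt M → ℝ} (hd : Measurable d)
    {A : Set (Pt M × Label)} (hA : MeasurableSet A) :
    (((finLaw a p).withDensity fun x => ENNReal.ofReal (d x)).map (fun x => (x, ψ x))) A =
      ∑ i, ENNReal.ofReal (a i) * (ENNReal.ofReal (d (p i)) *
        A.indicator 1 (p i, ψ (p i))) := by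
  have hm : Measurable fun x : Pt M => (x, ψ x) := measurable_id.prodMk hψ
  rw [Measure.map_apply hm hA, withDensity_apply _ (hm hA), ← lintegral_indicator (hm hA),
    lintegral_finLaw _ _ (hd.ennreal_ofReal.indicator (hm hA))]
  apply Finset.sum_congr rfl
  intro i _
  by_cases h : (p i, ψ (p i)) ∈ A
  · simp [Set.indicator, h]
  · simp [Set.indicator, h]

lemma noisyLaw_finLaw_apply {M : ℕ} {I : Type*} [Fintype I] (a : I → ℝ) (p : I → Pt M)
    {f : Pt M → Label} (hf : Measurable f) {flip : Pt M → ℝ} (hflip : Measurable flip)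
    {A : Set (Pt M × Label)} (hA : MeasurableSet A) :
    noisyLaw (finLaw a p) f flip A = ∑ i, ENNReal.ofReal (a i) *
      (ENNReal.ofReal (1 - flip (p i)) * A.indicator 1 (p i, f (p i)) +
        ENNReal.ofReal (flip (p i)) * A.indicator 1 (p i, -f (p i))) := by
  unfold noisyLaw
  have hnf : Measurable fun x => -f x := (measurable_of_countable fun y : Label => -y).comp hf
  rw [Measure.add_apply, withDensity_map_finLaw_apply a p hf
      (show Measurable fun x => 1 - flip x from measurable_const.sub hflip) hA,
    withDensity_map_finLaw_apply a p hnf hflip hA, ← Finset.sum_add_distrib]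
  simp only [mul_add]

/-! ### The polynomial lift -/

/-- The indices of the affine coordinates `1`, `x₀`, `x`. -/
abbrev Var (m : ℕ) : Type := Option (Option (Fin m × Bool))

/-- The monomials of degree one in each of the affine factors indexed by `W × Bool`. -/
abbrev Mono (m : ℕ) (W : Finset ℕ) : Type := (↥W × Bool) → Var m

/-- The affine coordinates `(1, x₀, x)`. -/
def affineCoord {m q : ℕ} (x : Fin m × Bool → Fin q) (x₀ : ℕ) : Var m → ℝ
  | none => 1
  | some none => x₀
  | some (some p) => (x p : ℕ)

/-- The coefficients of the affine function `hiddenSum v x - x₀ - r`. -/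
def affineCoeff {m : ℕ} (v : Fin m → Bool) (r : ℝ) : Var m → ℝ
  | none => -r
  | some none => -1
  | some (some p) => if p.2 = v p.1 then 1 else 0

lemma sum_affineCoeff_mul {m q : ℕ} (v : Fin m → Bool) (r : ℝ) (x : Fin m × Bool → Fin q)
    (x₀ : ℕ) : ∑ k, affineCoeff v r k * affineCoord x x₀ k = (hiddenSum v x : ℝ) - x₀ - r := by
  rw [Fintype.sum_option, Fintype.sum_option, Fintype.sum_prod_type]
  have : ∀ i : Fin m, ∑ b : Bool, affineCoeff v r (some (some (i, b))) *
      affineCoord x x₀ (some (some (i, b))) = ((x (i, v i) : ℕ) : ℝ) := by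
    intro i
    simp only [Fintype.sum_bool, affineCoeff, affineCoord]
    cases v i <;> simp
  simp only [this]
  simp only [affineCoeff, affineCoord, hiddenSum]
  push_cast
  ring

/-- The sign changes of the separating polynomial. -/
noncomputable def cellRoot (q : ℕ) {W : Finset ℕ} (j : ↥W × Bool) : ℝ :=
  q * (j.1 : ℕ) + if j.2 then 1 / 2 else 3 / 2

section lift

variable {m q M : ℕ} {W : Finset ℕ} (e : Mono m W ↪ Fin M)

/-- The vector of all monomials evaluated at `(1, x₀, x)`. -/
noncomputable def monoLift (x : Fin m × Bool → Fin q) (x₀ : ℕ) : Pt M :=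
  WithLp.toLp 2 (Function.extend e (fun s => ∏ j, affineCoord x x₀ (s j)) 0)

/-- The coefficient vector of the separating polynomial. -/
noncomputable def sepWeight (q : ℕ) (v : Fin m → Bool) : Pt M :=
  WithLp.toLp 2 (Function.extend e (fun s => ∏ j, affineCoeff v (cellRoot q j) (s j)) 0)

/-- Expanding the product of affine forms picks one variable per factor, that is, an element of
`Mono m W`. Equal monomials from different choices stay separate coordinates, and coordinates
outside the range of `e` vanish. -/
lemma inner_sepWeight_monoLift (v : Fin m → Bool) (x : Fin m × Bool → Fin q) (x₀ : ℕ) :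
    inner ℝ (sepWeight e q v) (monoLift e x x₀) =
      ∏ n ∈ W, (((hiddenSum v x : ℝ) - x₀ - (q * n + 1 / 2)) *
        ((hiddenSum v x : ℝ) - x₀ - (q * n + 3 / 2))) := by
  have h1 : inner ℝ (sepWeight e q v) (monoLift e x x₀) =
      ∑ s : Mono m W, (∏ j, affineCoeff v (cellRoot q j) (s j)) * ∏ j, affineCoord x x₀ (s j) := by
    rw [PiLp.inner_apply]
    symm
    apply Finset.sum_of_injOn e e.injective.injOn (by simp)
    · intro k _ hk
      have : ¬ ∃ s, e s = k := by simpa using hk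
      simp [sepWeight, Function.extend_apply' _ _ _ this]
    · intro s _
      simp [sepWeight, monoLift, e.injective.extend_apply, mul_comm]
  have h2 := Finset.prod_univ_sum (fun _ : ↥W × Bool => (Finset.univ : Finset (Var m)))
    (fun j k => affineCoeff v (cellRoot q j) k * affineCoord x x₀ k)
  rw [Fintype.piFinset_univ] at h2
  rw [h1]
  simp only [← Finset.prod_mul_distrib]
  rw [← h2]
  simp only [sum_affineCoeff_mul]
  rw [Fintype.prod_prod_type]
  simp only [Fintype.prod_bool, cellRoot]
  rw [← Finset.prod_coe_sort W]
  simp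

/-- One factor can pick any affine coordinate while all others pick the constant `1`, so the lift
contains the affine coordinates themselves. -/
lemma monoLift_injective (hW : W.Nonempty) {x x' : Fin m × Bool → Fin q} {x₀ x₀' : ℕ}
    (h : monoLift e x x₀ = monoLift e x' x₀') : x = x' ∧ x₀ = x₀' := by
  obtain ⟨n, hn⟩ := hW
  have key : ∀ k : Var m, affineCoord x x₀ k = affineCoord x' x₀' k := by
    intro k
    let j₀ : ↥W × Bool := (⟨n, hn⟩, true)
    let s : Mono m W := Function.update (fun _ => none) j₀ k
    have hs : ∀ (y : Fin m × Bool → Fin q) (y₀ : ℕ),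
        (monoLift e y y₀) (e s) = affineCoord y y₀ k := by
      intro y y₀
      simp only [monoLift, e.injective.extend_apply]
      rw [Finset.prod_eq_single j₀]
      · simp [s]
      · intro j _ hj
        simp [s, Function.update_of_ne hj, affineCoord]
      · simp
    rw [← hs, ← hs, h]
  refine ⟨?_, ?_⟩
  · funext p
    have := key (some (some p))
    simp only [affineCoord, Nat.cast_inj] at this
    exact Fin.ext this
  · simpa [affineCoord] using key (some none)

/-- The cell and residue conditions under which the label is visible in `x₀`. -/
def Shifted (q : ℕ) (W : Finset ℕ) (z : ℕ) : Prop := z % q ≠ 0 ∧ z / q ∈ W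

instance (q : ℕ) (W : Finset ℕ) (z : ℕ) : Decidable (Shifted q W z) := by
  unfold Shifted; infer_instance

lemma sub_mod_cast (q z : ℕ) : (z : ℝ) - (z % q : ℕ) = q * (z / q : ℕ) := by
  have := Nat.div_add_mod z q
  have h : (z : ℝ) = q * (z / q : ℕ) + (z % q : ℕ) := by exact_mod_cast this.symm
  linarith

lemma cell_sq_ge {q : ℕ} (hq : 2 ≤ q) {a b : ℕ} (h : a ≠ b) :
    (2 : ℝ) ≤ q * a - q * b ∨ (q : ℝ) * a - q * b ≤ -2 := by
  have hq' : (2 : ℝ) ≤ q := by exact_mod_cast hq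
  rcases lt_or_gt_of_ne h with h | h
  · right
    have : (a : ℝ) + 1 ≤ b := by exact_mod_cast h
    nlinarith
  · left
    have : (b : ℝ) + 1 ≤ a := by exact_mod_cast h
    nlinarith

/-- Since `q ≥ 2`, each pair of roots lies strictly between consecutive multiples of `q`, so every
quadratic factor is positive there. -/
lemma halfspace_of_unshifted (hq : 2 ≤ q) (v : Fin m → Bool) (x : Fin m × Bool → Fin q) :
    halfspace (sepWeight e q v) (monoLift e x (hiddenSum v x % q)) = 1 := by
  unfold halfspace
  rw [if_pos]
  rw [inner_sepWeight_monoLift, sub_mod_cast]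
  apply Finset.prod_nonneg
  intro n _
  by_cases h : hiddenSum v x / q = n
  · rw [h]
    norm_num
  · rcases cell_sq_ge hq h with h | h <;> nlinarith

/-- Here `z - x₀ = q * n + 1` lies between the two roots of its own cell and outside every other
pair. -/
lemma halfspace_of_shifted (hq : 2 ≤ q) (v : Fin m → Bool) (x : Fin m × Bool → Fin q)
    (hx : Shifted q W (hiddenSum v x)) :
    halfspace (sepWeight e q v) (monoLift e x (foldRes q W (hiddenSum v x))) = -1 := by
  unfold halfspace
  rw [if_neg]
  have hz : (hiddenSum v x : ℝ) - (foldRes q W (hiddenSum v x) : ℕ) =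
      q * (hiddenSum v x / q : ℕ) + 1 := by
    have := sub_mod_cast q (hiddenSum v x)
    unfold foldRes
    rw [if_pos (show _ ∧ _ from hx), Nat.cast_sub (Nat.one_le_iff_ne_zero.mpr hx.1)]
    push_cast
    linarith
  rw [inner_sepWeight_monoLift, hz, not_le, ← Finset.mul_prod_erase _ _ hx.2]
  apply mul_neg_of_neg_of_pos
  · norm_num
  · apply Finset.prod_pos
    intro n hn
    rcases cell_sq_ge hq (Finset.ne_of_mem_erase hn).symm with h | h <;> nlinarith

end lift

/-! ### The hard distributions -/

/-- The label encoded by a Boolean. -/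
def boolLabel (b : Bool) : Label := if b then 1 else -1

/-- The probability of a label. -/
noncomputable def labelMass (η : ℝ) (b : Bool) : ℝ := if b then 1 - η else η

lemma labelMass_nonneg {η : ℝ} (h0 : 0 ≤ η) (h1 : η ≤ 1 / 2) (b : Bool) : 0 ≤ labelMass η b := by
  cases b <;> simp [labelMass] <;> linarith

/-- The residues are shifted for negative labels only. -/
def labelWindow (W : Finset ℕ) (b : Bool) : Finset ℕ := if b then ∅ else W

section hard

variable {m q M : ℕ} {W : Finset ℕ} (e : Mono m W ↪ Fin M)

/-- The example generated from the seed `(x, b)`. -/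
noncomputable def hardPoint (v : Fin m → Bool) (p : (Fin m × Bool → Fin q) × Bool) : Pt M :=
  monoLift e p.1 (foldRes q (labelWindow W p.2) (hiddenSum v p.1))

/-- The probability of the seed `(x, b)`. -/
noncomputable def hardMass (m q : ℕ) (η : ℝ) (p : (Fin m × Bool → Fin q) × Bool) : ℝ :=
  labelMass η p.2 / Fintype.card (Fin m × Bool → Fin q)

/-- The distribution with hidden vector `v`. -/
noncomputable def hardLaw (q : ℕ) (η : ℝ) (v : Fin m → Bool) : Measure (Pt M × Label) :=
  finLaw (hardMass m q η) fun p => (hardPoint e v p, boolLabel p.2)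

lemma hardMass_nonneg {η : ℝ} (h0 : 0 ≤ η) (h1 : η ≤ 1 / 2)
    (p : (Fin m × Bool → Fin q) × Bool) : 0 ≤ hardMass m q η p :=
  div_nonneg (labelMass_nonneg h0 h1 _) (by positivity)

lemma hardPoint_true (v : Fin m → Bool) (x : Fin m × Bool → Fin q) :
    hardPoint e v (x, true) = monoLift e x (hiddenSum v x % q) := by
  simp [hardPoint, labelWindow, foldRes_empty]

lemma hardPoint_false (v : Fin m → Bool) (x : Fin m × Bool → Fin q) :
    hardPoint e v (x, false) = monoLift e x (foldRes q W (hiddenSum v x)) := by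
  simp [hardPoint, labelWindow]

lemma hardPoint_false_of_not_shifted {v : Fin m → Bool} {x : Fin m × Bool → Fin q}
    (hx : ¬ Shifted q W (hiddenSum v x)) : hardPoint e v (x, false) = hardPoint e v (x, true) := by
  rw [hardPoint_false, hardPoint_true, foldRes, if_neg (show ¬ (_ ∧ _) from hx)]

/-- The examples that do not determine their label. -/
def noisySet (q : ℕ) (v : Fin m → Bool) : Set (Pt M) :=
  {z | ∃ x : Fin m × Bool → Fin q, ¬ Shifted q W (hiddenSum v x) ∧ z = hardPoint e v (x, true)}

lemma hardPoint_mem_noisySet_iff (hW : W.Nonempty) (v : Fin m → Bool)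
    (p : (Fin m × Bool → Fin q) × Bool) :
    hardPoint e v p ∈ noisySet e q v ↔ ¬ Shifted q W (hiddenSum v p.1) := by
  constructor
  · rintro ⟨x, hx, h⟩
    rwa [(monoLift_injective e hW h).1]
  · rintro h
    obtain ⟨x, b⟩ := p
    refine ⟨x, h, ?_⟩
    cases b
    · exact hardPoint_false_of_not_shifted e h
    · rfl

lemma measurableSet_noisySet (q : ℕ) (v : Fin m → Bool) : MeasurableSet (noisySet e q v) := by
  apply Set.Finite.measurableSet
  apply (Set.finite_range fun x : Fin m × Bool → Fin q => hardPoint e v (x, true)).subset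
  rintro z ⟨x, -, rfl⟩
  exact ⟨x, rfl⟩

/-- The flipping probability of the hard distributions. -/
noncomputable def hardFlip (q : ℕ) (η : ℝ) (v : Fin m → Bool) : Pt M → ℝ :=
  (noisySet e q v).indicator fun _ => η

lemma measurable_hardFlip (q : ℕ) (η : ℝ) (v : Fin m → Bool) : Measurable (hardFlip e q η v) :=
  measurable_const.indicator (measurableSet_noisySet e q v)

lemma hardFlip_eq (η : ℝ) (v : Fin m → Bool) (z : Pt M) :
    hardFlip e q η v z = 0 ∨ hardFlip e q η v z = η := by
  unfold hardFlip Set.indicator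
  split_ifs <;> simp

/-- The laws agree for each `x` separately. If `x` is shifted, the halfspace recovers both labels
without noise; if not, the seeds `(x, true)` and `(x, false)` are one point carrying its labels in
proportion `1 - η` to `η`. -/
lemma hardLaw_eq_noisyLaw (hq : 2 ≤ q) (hW : W.Nonempty) {η : ℝ} (h0 : 0 ≤ η) (h1 : η ≤ 1 / 2)
    (v : Fin m → Bool) :
    hardLaw e q η v = noisyLaw (finLaw (hardMass m q η) (hardPoint e v))
      (halfspace (sepWeight e q v)) (hardFlip e q η v) := by
  ext A hA
  rw [noisyLaw_finLaw_apply _ _ (measurable_halfspace _)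
    (measurable_hardFlip e q η v) hA]
  have hl : hardLaw e q η v A = ∑ p, ENNReal.ofReal (hardMass m q η p) *
      A.indicator 1 (hardPoint e v p, boolLabel p.2) := by
    unfold hardLaw finLaw
    rw [Measure.finsetSum_apply]
    simp only [Measure.smul_apply, Measure.dirac_apply' _ hA, smul_eq_mul]
  rw [hl, Fintype.sum_prod_type, Fintype.sum_prod_type]
  apply Finset.sum_congr rfl
  intro x _
  simp only [Fintype.sum_bool]
  have ht : halfspace (sepWeight e q v) (hardPoint e v (x, true)) = 1 := by
    rw [hardPoint_true]; exact halfspace_of_unshifted e hq v x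
  by_cases hx : Shifted q W (hiddenSum v x)
  · have hf : halfspace (sepWeight e q v) (hardPoint e v (x, false)) = -1 := by
      rw [hardPoint_false]; exact halfspace_of_shifted e hq v x hx
    have hn : ∀ b, hardFlip e q η v (hardPoint e v (x, b)) = 0 := by
      intro b
      apply Set.indicator_of_notMem
      rw [hardPoint_mem_noisySet_iff e hW]
      exact not_not.mpr hx
    rw [hn, hn, ht, hf]
    simp [boolLabel]
  · have hn : hardFlip e q η v (hardPoint e v (x, true)) = η := by
      apply Set.indicator_of_mem
      rwa [hardPoint_mem_noisySet_iff e hW]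
    rw [hardPoint_false_of_not_shifted e hx, hn, ht]
    simp only [boolLabel, hardMass, labelMass, if_true, Bool.false_eq_true, if_false]
    set c : ℝ := (Fintype.card (Fin m × Bool → Fin q) : ℝ)
    have hc : 0 ≤ c := by positivity
    have e1 : ENNReal.ofReal ((1 - η) / c) = ENNReal.ofReal (1 - η) * ENNReal.ofReal c⁻¹ := by
      rw [← ENNReal.ofReal_mul (by linarith), div_eq_mul_inv]
    have e2 : ENNReal.ofReal (η / c) = ENNReal.ofReal η * ENNReal.ofReal c⁻¹ := by
      rw [← ENNReal.ofReal_mul h0, div_eq_mul_inv]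
    have e3 : ENNReal.ofReal (1 - η) + ENNReal.ofReal η = 1 := by
      rw [← ENNReal.ofReal_add (by linarith) h0]; simp
    rw [← add_mul, e1, e2, ← add_mul, e3]
    ring

lemma measurableSet_misclassified {h : Pt M → Label} (hh : Measurable h) :
    MeasurableSet {z : Pt M × Label | h z.1 ≠ z.2} :=
  (measurableSet_eq_fun (hh.comp measurable_fst) measurable_snd).compl

lemma err_hardLaw (hq : 2 ≤ q) {η : ℝ} (h0 : 0 ≤ η) (h1 : η ≤ 1 / 2) (v : Fin m → Bool) :
    err (hardLaw e q η v) (halfspace (sepWeight e q v)) =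
      η / Fintype.card (Fin m × Bool → Fin q) * (Finset.univ.filter
        fun x : Fin m × Bool → Fin q => ¬ Shifted q W (hiddenSum v x)).card := by
  unfold err hardLaw
  rw [real_finLaw (hardMass_nonneg h0 h1) _ (measurableSet_misclassified (measurable_halfspace _)),
    Fintype.sum_prod_type, Finset.card_filter, Nat.cast_sum, Finset.mul_sum]
  apply Finset.sum_congr rfl
  intro x _
  simp only [Fintype.sum_bool]
  have ht : halfspace (sepWeight e q v) (hardPoint e v (x, true)) = 1 := by
    rw [hardPoint_true]; exact halfspace_of_unshifted e hq v x
  by_cases hx : Shifted q W (hiddenSum v x)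
  · have hf : halfspace (sepWeight e q v) (hardPoint e v (x, false)) = -1 := by
      rw [hardPoint_false]; exact halfspace_of_shifted e hq v x hx
    simp [Set.indicator, ht, hf, hx, boolLabel]
  · have hne : (1 : Label) ≠ -1 := by decide
    simp [Set.indicator, hardPoint_false_of_not_shifted e hx, ht, hx, boolLabel, hardMass,
      labelMass, hne]

lemma hardLaw_mem_massartHalfspaces (hq : 2 ≤ q) (hW : W.Nonempty) {η ζ : ℝ} (h0 : 0 ≤ η)
    (h1 : η ≤ 1 / 2) (v : Fin m → Bool)
    (hζ : η * (Finset.univ.filter fun x : Fin m × Bool → Fin q =>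
      ¬ Shifted q W (hiddenSum v x)).card ≤ ζ * Fintype.card (Fin m × Bool → Fin q)) :
    hardLaw e q η v ∈ massartHalfspaces M η ζ := by
  have : Nonempty (Fin q) := ⟨⟨0, by omega⟩⟩
  have hc : (0 : ℝ) < Fintype.card (Fin m × Bool → Fin q) := by
    exact_mod_cast Fintype.card_pos
  refine ⟨sepWeight e q v, finLaw (hardMass m q η) (hardPoint e v), hardFlip e q η v,
    ⟨?_, measurable_hardFlip e q η v, ?_, ?_,
      hardLaw_eq_noisyLaw e hq hW h0 h1 v⟩, hardFlip_eq e η v, ?_⟩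
  · apply isProbabilityMeasure_finLaw (hardMass_nonneg h0 h1)
    simp only [Fintype.sum_prod_type, Fintype.sum_bool, hardMass, labelMass, ← add_div]
    simp only [if_true, Bool.false_eq_true, if_false, Finset.sum_const, Finset.card_univ,
      nsmul_eq_mul]
    field_simp
    ring
  · intro z
    rcases hardFlip_eq (q := q) e η v z with h | h <;> rw [h]
    exact h0
  · intro z
    rcases hardFlip_eq (q := q) e η v z with h | h <;> rw [h]
    exact h0
  · rw [err_hardLaw e hq h0 h1, div_mul_eq_mul_div, div_le_iff₀ hc]
    exact hζ

/-! ### Statistical queries against the hard distributions -/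

/-- The average of `h` when `x₀` and `x` are independent and uniform and the label is `b`. -/
noncomputable def nullAvg (q : ℕ) (h : Pt M × Label → ℝ) (b : Bool) : ℝ :=
  (∑ x : Fin m × Bool → Fin q, ∑ k : Fin q, h (monoLift e x k, boolLabel b)) / q /
    Fintype.card (Fin m × Bool → Fin q)

/-- The average of `h` when `x₀`, `x` and the label are independent. -/
noncomputable def nullMean (q : ℕ) (η : ℝ) (h : Pt M × Label → ℝ) : ℝ :=
  (1 - η) * nullAvg e q h true + η * nullAvg e q h false

/-- The average of `h` under the hidden vector `v`, given the label `b`. -/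
noncomputable def hardAvg (q : ℕ) (h : Pt M × Label → ℝ) (v : Fin m → Bool) (b : Bool) : ℝ :=
  (∑ x : Fin m × Bool → Fin q, h (hardPoint e v (x, b), boolLabel b)) /
    Fintype.card (Fin m × Bool → Fin q)

lemma integral_hardLaw {η : ℝ} (h0 : 0 ≤ η) (h1 : η ≤ 1 / 2) (v : Fin m → Bool)
    {h : Pt M × Label → ℝ} (hh : Measurable h) :
    ∫ z, h z ∂(hardLaw e q η v) = (1 - η) * hardAvg e q h v true + η * hardAvg e q h v false := by
  unfold hardLaw
  rw [integral_finLaw (hardMass_nonneg h0 h1) _ hh, Fintype.sum_prod_type]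
  simp only [Fintype.sum_bool, hardMass, labelMass, hardAvg, Finset.sum_add_distrib,
    ← Finset.mul_sum]
  simp only [if_true, Bool.false_eq_true, if_false, ← Finset.mul_sum]
  ring

/-- The map producing `x₀` from `x`, given the label `b`. -/
def residueMap (hq : 0 < q) (W : Finset ℕ) (b : Bool) (v : Fin m → Bool)
    (x : Fin m × Bool → Fin q) : Fin q :=
  ⟨foldRes q (labelWindow W b) (hiddenSum v x), foldRes_lt hq _ _⟩

lemma card_hardAvg_sub_le (hq : 0 < q) {h : Pt M × Label → ℝ} (hh : ∀ z, |h z| ≤ 1) (b : Bool)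
    {τ : ℝ} (hτ : 0 < τ) (hτq : 8 / q ≤ τ ^ 2) {σ : ℝ} (hσ : |σ| ≤ 1) (S : Finset (Fin m → Bool))
    (hS : ∀ v ∈ S, τ ≤ σ * (hardAvg e q h v b - nullAvg e q h b)) :
    (S.card : ℝ) ≤ 2 * q / τ ^ 2 := by
  have : Nonempty (Fin q) := ⟨⟨0, hq⟩⟩
  have hq' : (0 : ℝ) < q := by exact_mod_cast hq
  have hc : (0 : ℝ) < Fintype.card (Fin m × Bool → Fin q) := by
    exact_mod_cast Fintype.card_pos
  have key := card_mul_le_of_correlated (residueMap hq W b) S 4 (by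
      intro u v huv
      have := card_collision_le (q := q) (labelWindow W b) huv
      simp only [Fintype.card_fin, residueMap, Fin.mk.injEq]
      exact_mod_cast this) (by norm_num) (by simpa using hq)
    (fun x k => σ * h (monoLift e x k, boolLabel b)) (by
      intro x k
      rw [abs_mul]
      exact mul_le_one₀ hσ (abs_nonneg _) (hh _)) hτ.le (by
      intro v hv
      have h2 := mul_le_mul_of_nonneg_right (hS v hv) hc.le
      refine h2.trans (le_of_eq ?_)
      simp only [hardAvg, nullAvg, hardPoint, residueMap, Fintype.card_fin, ← Finset.mul_sum]
      field_simp)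
  rw [Fintype.card_fin] at key
  rw [le_div_iff₀ (by positivity)]
  -- The collision excess `4 / q` costs at most half of `τ ^ 2`.
  have : (4 : ℝ) / q = (8 / q) / 2 := by ring
  have h3 : (S.card : ℝ) * (τ ^ 2 / 2) ≤ S.card * (τ ^ 2 - 4 / q) :=
    mul_le_mul_of_nonneg_left (by linarith) (by positivity)
  linarith

open Classical in
/-- The hidden vectors for which the mean of `h` is far from its mean under independence. -/
noncomputable def visible (q : ℕ) (η τ : ℝ) (h : Pt M × Label → ℝ) : Finset (Fin m → Bool) :=
  Finset.univ.filter fun v => τ < |∫ z, h z ∂(hardLaw e q η v) - nullMean e q η h|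

lemma card_visible_le (hq : 0 < q) {η : ℝ} (h0 : 0 ≤ η) (h1 : η ≤ 1 / 2)
    {h : Pt M × Label → ℝ} (hm : Measurable h) (hh : ∀ z, |h z| ≤ 1)
    {τ : ℝ} (hτ : 0 < τ) (hτq : 8 / q ≤ τ ^ 2) :
    ((visible e q η τ h).card : ℝ) ≤ 8 * q / τ ^ 2 := by
  classical
  let T : Bool → ℝ → Finset (Fin m → Bool) := fun b σ =>
    Finset.univ.filter fun v => τ ≤ σ * (hardAvg e q h v b - nullAvg e q h b)
  have hT : ∀ b σ, |σ| ≤ 1 → ((T b σ).card : ℝ) ≤ 2 * q / τ ^ 2 := by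
    intro b σ hσ
    apply card_hardAvg_sub_le e hq hh b hτ hτq hσ
    intro v hv
    exact (Finset.mem_filter.mp hv).2
  -- The deviation is a convex combination of those for the two labels, so one of the four one-sided
  -- deviations reaches `τ`.
  have hsub : visible e q η τ h ⊆ (T true 1 ∪ T true (-1)) ∪ (T false 1 ∪ T false (-1)) := by
    intro v hv
    by_contra hcon
    simp only [T, Finset.mem_union, Finset.mem_filter, Finset.mem_univ, true_and, not_or,
      not_le] at hcon
    have hv := (Finset.mem_filter.mp hv).2
    rw [integral_hardLaw e h0 h1 v hm, nullMean, lt_abs] at hv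
    obtain ⟨⟨a1, a2⟩, a3, a4⟩ := hcon
    rcases hv with hv | hv <;> nlinarith
  have hcard := (Finset.card_le_card hsub).trans ((Finset.card_union_le _ _).trans
    (add_le_add (Finset.card_union_le _ _) (Finset.card_union_le _ _)))
  have : ((visible e q η τ h).card : ℝ) ≤ ((T true 1).card + (T true (-1)).card) +
      ((T false 1).card + (T false (-1)).card) := by exact_mod_cast hcard
  have b1 := hT true 1 (by simp)
  have b2 := hT true (-1) (by simp)
  have b3 := hT false 1 (by simp)
  have b4 := hT false (-1) (by simp)
  have : 8 * q / τ ^ 2 = 4 * (2 * q / τ ^ 2) := by ring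
  linarith

/-- The indicator function of misclassification. -/
noncomputable def errTest (h : Pt M → Label) : Pt M × Label → ℝ :=
  {z | h z.1 ≠ z.2}.indicator 1

lemma measurable_errTest {h : Pt M → Label} (hh : Measurable h) : Measurable (errTest h) :=
  measurable_one.indicator (measurableSet_misclassified hh)

lemma abs_errTest_le (h : Pt M → Label) (z : Pt M × Label) : |errTest h z| ≤ 1 := by
  unfold errTest Set.indicator
  split_ifs <;> simp

lemma integral_errTest {h : Pt M → Label} (hh : Measurable h) (D : Measure (Pt M × Label)) :
    ∫ z, errTest h z ∂D = err D h :=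
  integral_indicator_one (measurableSet_misclassified hh)

/-- When the label is independent of the example, either prediction at a point errs with probability
`η` or `1 - η`. -/
lemma le_nullMean_errTest (hq : 0 < q) {η : ℝ} (h1 : η ≤ 1 / 2) (h : Pt M → Label) :
    η ≤ nullMean e q η (errTest h) := by
  have : Nonempty (Fin q) := ⟨⟨0, hq⟩⟩
  have hq' : (0 : ℝ) < q := by exact_mod_cast hq
  have hc : (0 : ℝ) < Fintype.card (Fin m × Bool → Fin q) := by
    exact_mod_cast Fintype.card_pos
  have hpt : ∀ p : Pt M, η ≤ (1 - η) * errTest h (p, boolLabel true) +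
      η * errTest h (p, boolLabel false) := by
    intro p
    have hne : (1 : Label) ≠ -1 := by decide
    have hne' : (-1 : Label) ≠ 1 := by decide
    rcases Int.units_eq_one_or (h p) with hp | hp
    · simp [errTest, Set.indicator, boolLabel, hp, hne]
    · simp [errTest, Set.indicator, boolLabel, hp, hne']
      linarith
  have e1 : nullMean e q η (errTest h) = (∑ x : Fin m × Bool → Fin q, ∑ k : Fin q,
      ((1 - η) * errTest h (monoLift e x k, boolLabel true) +
        η * errTest h (monoLift e x k, boolLabel false))) / q /
          Fintype.card (Fin m × Bool → Fin q) := by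
    simp only [nullMean, nullAvg, Finset.sum_add_distrib, ← Finset.mul_sum]
    ring
  rw [e1, le_div_iff₀ hc, le_div_iff₀ hq']
  have : ∑ x : Fin m × Bool → Fin q, ∑ k : Fin q, η ≤ ∑ x : Fin m × Bool → Fin q, ∑ k : Fin q,
      ((1 - η) * errTest h (monoLift e x k, boolLabel true) +
        η * errTest h (monoLift e x k, boolLabel false)) :=
    Finset.sum_le_sum fun x _ => Finset.sum_le_sum fun k _ => hpt _
  refine le_trans (le_of_eq ?_) this
  simp only [Finset.sum_const, Finset.card_univ, nsmul_eq_mul, Fintype.card_fin]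
  ring

end hard

/-! ### Statistical query lower bound -/

section adversary

variable {m q M : ℕ} {W : Finset ℕ} (e : Mono m W ↪ Fin M)

open Classical in
/-- The oracle that answers as if the label were independent of the example whenever it may. -/
noncomputable def hardOracle (q : ℕ) (η τ : ℝ) (v : Fin m → Bool) (s : StatQuery M) : ℝ :=
  if v ∈ visible e q η τ s.toFun then ∫ z, s.toFun z ∂(hardLaw e q η v)
  else nullMean e q η s.toFun

lemma isOracle_hardOracle (q : ℕ) {η τ : ℝ} (hτ : 0 ≤ τ) (v : Fin m → Bool) :
    IsOracle (hardLaw e q η v) τ (hardOracle e q η τ v) := by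
  intro s
  unfold hardOracle
  split_ifs with h
  · simpa using hτ
  · rw [abs_sub_comm]
    simpa [visible] using h

open Classical in
/-- The hidden vectors for which a deterministic algorithm succeeds with at most `N` queries. -/
noncomputable def solved (q : ℕ) (η τ : ℝ) (A : SQAlgorithm M) (N : ℕ) :
    Finset (Fin m → Bool) :=
  Finset.univ.filter fun v => A.numQueries (hardOracle e q η τ v) ≤ N ∧
    err (hardLaw e q η v) (A.run (hardOracle e q η τ v)).toFun < η - τ

/-- While `v` is invisible to the queries asked, the answers do not depend on `v` and the run
follows one fixed path. Each query on it, and finally the error test of the output, exposes at most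
`8 * q / τ ^ 2` vectors; the output test is the `+ 1`. -/
lemma card_solved_le (hq : 0 < q) {η : ℝ} (h0 : 0 ≤ η) (h1 : η ≤ 1 / 2) {τ : ℝ} (hτ : 0 < τ)
    (hτq : 8 / q ≤ τ ^ 2) (A : SQAlgorithm M) (N : ℕ) :
    ((solved e q η τ A N).card : ℝ) ≤ (N + 1) * (8 * q / τ ^ 2) := by
  classical
  have hB : 0 ≤ 8 * q / τ ^ 2 := by positivity
  induction A generalizing N with
  | output h =>
    have hsub : solved e q η τ (.output h) N ⊆ visible e q η τ (errTest h.toFun) := by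
      intro v hv
      have hv := (Finset.mem_filter.mp hv).2.2
      simp only [SQAlgorithm.run] at hv
      refine Finset.mem_filter.mpr ⟨Finset.mem_univ _, ?_⟩
      rw [integral_errTest h.measurable_toFun, lt_abs]
      right
      linarith [le_nullMean_errTest e hq h1 h.toFun]
    have hc : ((solved e q η τ (.output h) N).card : ℝ) ≤
        (visible e q η τ (errTest h.toFun)).card := by exact_mod_cast Finset.card_le_card hsub
    have := card_visible_le e hq h0 h1 (measurable_errTest h.measurable_toFun)
      (abs_errTest_le h.toFun) hτ hτq
    have hN : (0 : ℝ) ≤ N := by positivity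
    nlinarith
  | query s next ih =>
    cases N with
    | zero =>
      have : solved e q η τ (.query s next) 0 = ∅ := by
        ext v
        simp [solved, SQAlgorithm.numQueries]
      rw [this]
      simpa using hB
    | succ N =>
      have hsub : solved e q η τ (.query s next) (N + 1) ⊆
          visible e q η τ s.toFun ∪ solved e q η τ (next (nullMean e q η s.toFun)) N := by
        intro v hv
        rw [Finset.mem_union, or_iff_not_imp_left]
        intro hvis
        have hO : hardOracle e q η τ v s = nullMean e q η s.toFun := if_neg hvis
        have hv := (Finset.mem_filter.mp hv).2
        simp only [SQAlgorithm.numQueries, SQAlgorithm.run, hO] at hv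
        exact Finset.mem_filter.mpr ⟨Finset.mem_univ _, by omega, hv.2⟩
      have hc := (Finset.card_le_card hsub).trans (Finset.card_union_le _ _)
      have hc' : ((solved e q η τ (.query s next) (N + 1)).card : ℝ) ≤
          (visible e q η τ s.toFun).card +
            (solved e q η τ (next (nullMean e q η s.toFun)) N).card := by exact_mod_cast hc
      have b1 := card_visible_le e hq h0 h1 s.measurable_toFun s.abs_le_one hτ hτq
      have b2 := ih (nullMean e q η s.toFun) N
      push_cast
      linarith

/-- Events that together cover each outcome at most `B` times have total probability at
most `B`. -/
lemma sum_measureReal_le {Ω V : Type*} [MeasurableSpace Ω] (P : Measure Ω)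
    [IsProbabilityMeasure P] [Fintype V] (S : V → Set Ω) (hS : ∀ v, MeasurableSet (S v)) {B : ℝ}
    (hB : ∀ ω, ∑ v, (S v).indicator (1 : Ω → ℝ) ω ≤ B) : ∑ v, P.real (S v) ≤ B := by
  have hi : ∀ v, Integrable ((S v).indicator (1 : Ω → ℝ)) P := fun v =>
    (integrable_const (1 : ℝ)).indicator (hS v)
  calc ∑ v, P.real (S v) = ∑ v, ∫ ω, (S v).indicator (1 : Ω → ℝ) ω ∂P := by
        simp only [integral_indicator_one (hS _)]
    _ = ∫ ω, ∑ v, (S v).indicator (1 : Ω → ℝ) ω ∂P :=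
        (integral_finsetSum _ fun v _ => hi v).symm
    _ ≤ ∫ _, B ∂P := integral_mono (integrable_finsetSum _ fun v _ => hi v)
        (integrable_const _) hB
    _ = B := by simp

/-- Double counting of pairs `(v, ω)`: each `ω` succeeds for few `v`, whereas each `v` is solved
with probability at least `2/3`. -/
lemma not_learns_hard (hq : 0 < q) {η : ℝ} (h0 : 0 ≤ η) (h1 : η ≤ 1 / 2) {τ : ℝ} (hτ : 0 < τ)
    (hτ1 : τ ≤ 1) (hτq : 8 / q ≤ τ ^ 2) (hm : 24 * (q : ℝ) < τ ^ 3 * 2 ^ m)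
    {𝒟 : Set (Measure (Pt M × Label))} (h𝒟 : ∀ v, hardLaw e q η v ∈ 𝒟)
    {Ω : Type*} [MeasurableSpace Ω] (P : Measure Ω) [IsProbabilityMeasure P]
    (alg : Ω → SQAlgorithm M) : ¬ Learns P alg 𝒟 (1 / τ) τ (η - τ) := by
  classical
  intro hL
  choose S hSm hSp hS using fun v => hL _ (h𝒟 v) _ (isOracle_hardOracle e q hτ.le v)
  have hq' : (0 : ℝ) < q := by exact_mod_cast hq
  have hle := sum_measureReal_le P S hSm (B := (1 / τ + 1) * (8 * q / τ ^ 2)) (by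
    intro ω
    have hsub : (Finset.univ.filter fun v => ω ∈ S v) ⊆
        solved e q η τ (alg ω) ⌊1 / τ⌋₊ := by
      intro v hv
      have := hS v ω (Finset.mem_filter.mp hv).2
      exact Finset.mem_filter.mpr ⟨Finset.mem_univ _, Nat.le_floor this.1, this.2⟩
    have hc : ((Finset.univ.filter fun v => ω ∈ S v).card : ℝ) ≤
        (solved e q η τ (alg ω) ⌊1 / τ⌋₊).card := by exact_mod_cast Finset.card_le_card hsub
    have b := card_solved_le e hq h0 h1 hτ hτq (alg ω) ⌊1 / τ⌋₊
    have hfl : (⌊1 / τ⌋₊ : ℝ) ≤ 1 / τ := Nat.floor_le (by positivity)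
    have b' : ((⌊1 / τ⌋₊ : ℝ) + 1) * (8 * q / τ ^ 2) ≤ (1 / τ + 1) * (8 * q / τ ^ 2) :=
      mul_le_mul_of_nonneg_right (by linarith) (by positivity)
    have e1 : ∑ v, (S v).indicator (1 : Ω → ℝ) ω =
        ((Finset.univ.filter fun v => ω ∈ S v).card : ℝ) := by
      rw [Finset.card_filter, Nat.cast_sum]
      apply Finset.sum_congr rfl
      intro v _
      by_cases h : ω ∈ S v <;> simp [h]
    linarith)
  have hge : (2 : ℝ) / 3 * 2 ^ m ≤ ∑ v, P.real (S v) := by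
    have := Finset.card_nsmul_le_sum Finset.univ (fun v => P.real (S v)) (2 / 3) fun v _ => hSp v
    simp only [Finset.card_univ, Fintype.card_pi, Fintype.card_bool, Finset.prod_const,
      Fintype.card_fin, nsmul_eq_mul] at this
    push_cast at this
    linarith
  have h2 : (1 / τ + 1) * (8 * q / τ ^ 2) ≤ 16 * q / τ ^ 3 := by
    rw [le_div_iff₀ (by positivity)]
    have : (1 / τ + 1) * (8 * q / τ ^ 2) * τ ^ 3 = (1 + τ) * (8 * q) := by field_simp
    rw [this]
    nlinarith
  have h3 : 16 * q / τ ^ 3 < 2 / 3 * 2 ^ m := by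
    rw [div_lt_iff₀ (by positivity)]
    linarith
  linarith

end adversary

/-! ### The window -/

/-- The cells near the mean of the hidden sum. -/
def window (m ρ : ℕ) : Finset ℕ := Finset.Icc (m / 2 - (ρ + 2)) (m / 2 + (ρ + 2))

lemma window_nonempty (m ρ : ℕ) : (window m ρ).Nonempty :=
  ⟨m / 2, by simp [window]⟩

lemma card_window_le (m ρ : ℕ) : (window m ρ).card ≤ 2 * ρ + 5 := by
  simp only [window, Nat.card_Icc]
  omega

/-- As `m ≤ q`, the mean `m * (q - 1) / 2` is within `q / 2` of `q * (m / 2)`. The slack of two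
cells in `window` absorbs this, the residue and the rounding of `m / 2`. -/
lemma far_of_div_notMem_window {m q ρ z : ℕ} (hq : 0 < q) (hmq : m ≤ q)
    (hz : z / q ∉ window m ρ) : (ρ : ℝ) * q ≤ |(z : ℝ) - m * ((q - 1) / 2)| := by
  have hq' : (0 : ℝ) < q := by exact_mod_cast hq
  have hmq' : (m : ℝ) ≤ q := by exact_mod_cast hmq
  have hm0 : (0 : ℝ) ≤ m := by positivity
  have e1 := sub_mod_cast q z
  have e2 : ((z % q : ℕ) : ℝ) < q := by exact_mod_cast Nat.mod_lt z hq
  have e3 : (0 : ℝ) ≤ ((z % q : ℕ) : ℝ) := by positivity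
  generalize z / q = n at *
  have hz' : n + (ρ + 2) < m / 2 ∨ m / 2 + (ρ + 2) < n := by
    simp only [window, Finset.mem_Icc, not_and_or, not_le] at hz
    omega
  rcases hz' with h | h
  · have h' : 2 * (n : ℝ) + 2 * ρ + 6 ≤ m := by
      have : 2 * n + 2 * ρ + 6 ≤ m := by omega
      exact_mod_cast this
    rw [abs_sub_comm]
    refine le_trans ?_ (le_abs_self _)
    nlinarith
  · have h' : (m : ℝ) + 2 * ρ + 4 ≤ 2 * n := by
      have : m + 2 * ρ + 4 ≤ 2 * n := by omega
      exact_mod_cast this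
    refine le_trans ?_ (le_abs_self _)
    nlinarith

lemma card_not_shifted_le {m q ρ : ℕ} (hq : 0 < q) (hm : 0 < m) (hmq : m ≤ q)
    (v : Fin m → Bool) :
    ((Finset.univ.filter fun x : Fin m × Bool → Fin q =>
      ¬ Shifted q (window m ρ) (hiddenSum v x)).card : ℝ) ≤
      (1 / q + 2 * Real.exp (-(2 * ρ ^ 2 / m))) * Fintype.card (Fin m × Bool → Fin q) := by
  classical
  have hq' : (0 : ℝ) < q := by exact_mod_cast hq
  have hsub : (Finset.univ.filter fun x : Fin m × Bool → Fin q =>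
      ¬ Shifted q (window m ρ) (hiddenSum v x)) ⊆
      (Finset.univ.filter fun x : Fin m × Bool → Fin q => hiddenSum v x % q = 0) ∪
        (Finset.univ.filter fun x : Fin m × Bool → Fin q =>
          (ρ : ℝ) * q ≤ |(hiddenSum v x : ℝ) - m * ((q - 1) / 2)|) := by
    intro x hx
    have hx := (Finset.mem_filter.mp hx).2
    simp only [Finset.mem_union, Finset.mem_filter, Finset.mem_univ, true_and]
    rw [Shifted, not_and_or, not_not] at hx
    exact hx.imp id (far_of_div_notMem_window hq hmq)
  have hc := (Finset.card_le_card hsub).trans (Finset.card_union_le _ _)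
  have b1 := card_hiddenSum_mod_eq_zero_le (q := q) v ⟨0, hm⟩
  have b2 := card_hiddenSum_far_le hq hm v (r := (ρ : ℝ)) (by positivity)
  have b1' : ((Finset.univ.filter fun x : Fin m × Bool → Fin q =>
      hiddenSum v x % q = 0).card : ℝ) ≤ 1 / q * Fintype.card (Fin m × Bool → Fin q) := by
    rw [div_mul_eq_mul_div, one_mul, le_div_iff₀ hq', mul_comm]
    exact_mod_cast b1
  have hc' : ((Finset.univ.filter fun x : Fin m × Bool → Fin q =>
      ¬ Shifted q (window m ρ) (hiddenSum v x)).card : ℝ) ≤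
      (Finset.univ.filter fun x : Fin m × Bool → Fin q => hiddenSum v x % q = 0).card +
        (Finset.univ.filter fun x : Fin m × Bool → Fin q =>
          (ρ : ℝ) * q ≤ |(hiddenSum v x : ℝ) - m * ((q - 1) / 2)|).card := by exact_mod_cast hc
  rw [add_mul]
  linarith

/-- The lower bound in terms of the number of hidden bits, the modulus and the window. -/
lemma not_learns_of_params {m q ρ M : ℕ} (hq : 2 ≤ q) (hm : 0 < m) (hmq : m ≤ q) {η ζ τ : ℝ}
    (h0 : 0 ≤ η) (h1 : η ≤ 1 / 2) (hτ : 0 < τ) (hτ1 : τ ≤ 1) (hτq : 8 / q ≤ τ ^ 2)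
    (hτm : 24 * (q : ℝ) < τ ^ 3 * 2 ^ m) (hqζ : 1 / (q : ℝ) ≤ ζ)
    (hρ : 2 * Real.exp (-(2 * ρ ^ 2 / m)) ≤ ζ)
    (hM : (2 * m + 2) ^ (2 * (2 * ρ + 5)) ≤ M)
    {Ω : Type*} [MeasurableSpace Ω] (P : Measure Ω) [IsProbabilityMeasure P]
    (alg : Ω → SQAlgorithm M) :
    ¬ Learns P alg (massartHalfspaces M η ζ) (1 / τ) τ (η - τ) := by
  have hq0 : 0 < q := by omega
  have hcard : Fintype.card (Mono m (window m ρ)) ≤ Fintype.card (Fin M) := by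
    rw [Fintype.card_fin]
    refine le_trans ?_ hM
    simp only [Fintype.card_pi, Finset.prod_const, Finset.card_univ, Fintype.card_option,
      Fintype.card_prod, Fintype.card_fin, Fintype.card_bool, Fintype.card_coe]
    have e1 : m * 2 + 1 + 1 = 2 * m + 2 := by ring
    rw [e1]
    apply Nat.pow_le_pow_right (by omega)
    have := card_window_le m ρ
    omega
  obtain ⟨e⟩ := Function.Embedding.nonempty_of_card_le hcard
  refine not_learns_hard e hq0 h0 h1 hτ hτ1 hτq hτm (fun v => ?_) P alg
  apply hardLaw_mem_massartHalfspaces e hq (window_nonempty m ρ) h0 h1 v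
  have b := card_not_shifted_le (ρ := ρ) hq0 hm hmq v
  have hN : (0 : ℝ) ≤ Fintype.card (Fin m × Bool → Fin q) := by positivity
  set c : ℝ := ((Finset.univ.filter fun x : Fin m × Bool → Fin q =>
      ¬ Shifted q (window m ρ) (hiddenSum v x)).card : ℝ)
  have hc : 0 ≤ c := by positivity
  -- Both error terms are at most `ζ`, and `η ≤ 1/2` absorbs the factor two.
  nlinarith

/-! ### Choice of the parameters -/

/-- A large `ell` could come from `log log M` near `0`; integrality of `M` excludes this. A positive
`ell` forces `log M > 1`, so `M ≥ 3`, which bounds `log log M` away from `0`. -/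
lemma large_of_le_ell {M : ℕ} {ζ : ℝ} (hζ : 0 < ζ) (hζ2 : ζ ≤ 1 / 2)
    (h : 10 ^ 10 ≤ ell M ζ) :
    10 ^ 6 ≤ Real.log M ∧ 1 ≤ Real.log (Real.log M) ∧ 1 / 2 ≤ Real.log (1 / ζ) ∧
      Real.log (1 / ζ) ≤ Real.log M := by
  unfold ell at h
  have hB : 1 / 2 ≤ Real.log (1 / ζ) := by
    have h1 : Real.log 2 ≤ Real.log (1 / ζ) := by
      apply Real.log_le_log (by norm_num)
      rw [le_div_iff₀ hζ]
      linarith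
    linarith [Real.log_two_gt_d9]
  set L := Real.log M with hL
  set B := Real.log (1 / ζ) with hBdef
  have hL0 : 0 ≤ L := Real.log_natCast_nonneg M
  have hu : 0 < Real.log L := by
    by_contra hcon
    have h3 : Real.log L ^ 3 ≤ 0 := by
      have := mul_nonpos_of_nonpos_of_nonneg (not_lt.mp hcon) (sq_nonneg (Real.log L))
      calc Real.log L ^ 3 = Real.log L * Real.log L ^ 2 := by ring
        _ ≤ 0 := this
    have := div_nonpos_of_nonneg_of_nonpos hL0
      (mul_nonpos_of_nonpos_of_nonneg h3 (by linarith : (0 : ℝ) ≤ B))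
    linarith
  have hL1 : 1 < L := (Real.log_pos_iff hL0).mp hu
  have hM3 : (3 : ℝ) ≤ M := by
    have hM0 : (0 : ℝ) < M := by
      rcases Nat.eq_zero_or_pos M with h0 | h0
      · rw [hL, h0] at hL1
        norm_num at hL1
      · exact_mod_cast h0
    have h1 : Real.exp 1 < M := by
      rw [← Real.lt_log_iff_exp_lt hM0]
      exact hL1
    have : (2 : ℝ) < M := by linarith [Real.exp_one_gt_d9]
    have : 2 < M := by exact_mod_cast this
    exact_mod_cast this
  have hL109 : 1.09 ≤ L := by
    have h1 : Real.log 3 ≤ L := Real.log_le_log (by norm_num) hM3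
    have h2 : Real.log 3 = 1 + Real.log (3 / Real.exp 1) := by
      rw [Real.log_div (by norm_num) (Real.exp_pos 1).ne', Real.log_exp]
      ring
    have h3 := Real.one_sub_inv_le_log_of_pos (show 0 < 3 / Real.exp 1 by positivity)
    rw [inv_div] at h3
    have h4 := Real.exp_one_lt_d9
    linarith
  have hu08 : 0.08 ≤ Real.log L := by
    have h3 := Real.one_sub_inv_le_log_of_pos (show 0 < L by linarith)
    have h4 : L⁻¹ ≤ (1.09 : ℝ)⁻¹ := inv_anti₀ (by norm_num) hL109
    norm_num at h4 ⊢
    linarith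
  have hu3 : 0.0005 ≤ Real.log L ^ 3 := by
    have := pow_le_pow_left₀ (by norm_num) hu08 3
    norm_num at this ⊢
    linarith
  have hmul : 10 ^ 10 * (Real.log L ^ 3 * B) ≤ L := by
    rwa [le_div_iff₀ (by positivity)] at h
  have h5 : 0.0005 * B ≤ Real.log L ^ 3 * B := mul_le_mul_of_nonneg_right hu3 (by linarith)
  have hL6 : 10 ^ 6 ≤ L := by
    norm_num at h5 hmul ⊢
    linarith
  refine ⟨hL6, ?_, hB, ?_⟩
  · rw [Real.le_log_iff_exp_le (by linarith)]
    linarith [Real.exp_one_lt_d9]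
  · norm_num at h5 hmul ⊢
    linarith

lemma window_fits {M k ρ : ℕ} {K B : ℝ} (hL : 10 ^ 6 ≤ Real.log M)
    (hu : 1 ≤ Real.log (Real.log M)) (hB : 1 / 2 ≤ B) (hKL : Real.log M ≤ K)
    (hK : K * (Real.log (Real.log M) ^ 3 * B) = Real.log M ^ 2 / 10 ^ 4)
    (hk : (k : ℝ) ≤ 3 / 2 * K + 1) (hρ : (ρ : ℝ) ≤ √(((5 * k + 8 : ℕ) : ℝ) * B) + 1) :
    (2 * (5 * k + 8) + 2) ^ (2 * (2 * ρ + 5)) ≤ M := by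
  set L := Real.log M with hLdef
  set u := Real.log L with hudef
  have hK0 : 0 < K := by linarith
  -- Only the square of `log log M` is needed: one factor makes the window size `O(L / u)`, and the
  -- other cancels the logarithm of the base `2m + 2`.
  have hu3 : u ^ 2 ≤ u ^ 3 := pow_le_pow_right₀ hu (by norm_num)
  have hu31 : 1 ≤ u ^ 3 := one_le_pow₀ hu
  have hKB : K * B * u ^ 2 ≤ L ^ 2 / 10 ^ 4 := by
    rw [← hK]
    have := mul_le_mul_of_nonneg_left hu3 (by positivity : 0 ≤ K * B)
    linarith
  have hKL2 : K ≤ 2 * L ^ 2 / 10 ^ 4 := by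
    have h1 : K * (1 / 2) ≤ K * (u ^ 3 * B) := by
      apply mul_le_mul_of_nonneg_left _ hK0.le
      nlinarith
    linarith
  have hm : ((5 * k + 8 : ℕ) : ℝ) ≤ 8 * K := by
    push_cast
    linarith
  have hsqrt : √(((5 * k + 8 : ℕ) : ℝ) * B) ≤ 3 / 100 * (L / u) := by
    rw [Real.sqrt_le_left (by positivity)]
    have h1 : ((5 * k + 8 : ℕ) : ℝ) * B ≤ 8 * (K * B) := by
      have := mul_le_mul_of_nonneg_right hm (by linarith : (0 : ℝ) ≤ B)
      linarith
    have h2 : K * B ≤ L ^ 2 / 10 ^ 4 / u ^ 2 := by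
      rwa [le_div_iff₀ (by positivity)]
    have h3 : (3 / 100 * (L / u)) ^ 2 = 9 * (L ^ 2 / 10 ^ 4 / u ^ 2) := by
      field_simp
      norm_num
    have h4 : 0 ≤ L ^ 2 / 10 ^ 4 / u ^ 2 := by positivity
    rw [h3]
    linarith
  have hbase : Real.log ((2 * (5 * k + 8) + 2 : ℕ) : ℝ) ≤ 2 * u := by
    have h1 : ((2 * (5 * k + 8) + 2 : ℕ) : ℝ) ≤ L ^ 2 := by
      push_cast at hm ⊢
      nlinarith
    have h2 := Real.log_le_log (by positivity) h1
    rw [Real.log_pow] at h2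
    exact_mod_cast h2
  have huL : u ≤ L / 100 := by
    have h1 : u = 2 * Real.log √L := by
      rw [Real.log_sqrt (by linarith)]
      ring
    have h2 : Real.log √L ≤ √L := Real.log_le_self (Real.sqrt_nonneg L)
    have h3 : √L * √L = L := Real.mul_self_sqrt (by linarith)
    have h4 : 10 ^ 3 ≤ √L := Real.le_sqrt_of_sq_le (by norm_num at hL ⊢; linarith)
    nlinarith
  have hM0 : (0 : ℝ) < M := by
    rcases Nat.eq_zero_or_pos M with h0 | h0
    · rw [hLdef, h0] at hL
      norm_num at hL
    · exact_mod_cast h0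
  have hlog : Real.log (((2 * (5 * k + 8) + 2) ^ (2 * (2 * ρ + 5)) : ℕ) : ℝ) ≤ Real.log M := by
    rw [Nat.cast_pow, Real.log_pow]
    have hexp : ((2 * (2 * ρ + 5) : ℕ) : ℝ) ≤ 12 / 100 * (L / u) + 14 := by
      push_cast
      linarith
    calc _ ≤ (12 / 100 * (L / u) + 14) * (2 * u) :=
          mul_le_mul hexp hbase (Real.log_natCast_nonneg _) (by positivity)
      _ = 24 / 100 * L + 28 * u := by field_simp; ring
      _ ≤ L := by linarith
  have := (Real.log_le_log_iff (by positivity) hM0).mp hlog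
  exact_mod_cast this

lemma half_pow_le_exp_neg {K : ℝ} {k : ℕ} (hk : K ≤ k * Real.log 2) :
    (1 / 2 : ℝ) ^ k ≤ Real.exp (-K) := by
  have : (1 / 2 : ℝ) ^ k = Real.exp (-(k * Real.log 2)) := by
    rw [Real.exp_neg, mul_comm, Real.exp_mul, Real.exp_log (by norm_num)]
    simp
  rw [this]
  exact Real.exp_le_exp.mpr (by linarith)

end MassartSQ

/-! ### The main theorem. -/

theorem theorem4p1 :
    ∃ C c₁ c₂ : ℝ, 0 < C ∧ 0 < c₁ ∧ 0 < c₂ ∧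
      ∀ (ζ η : ℝ) (M : ℕ), 0 < ζ → ζ ≤ η → η ≤ 1 / 2 → C ≤ MassartSQ.ell M ζ →
        ∃ τ : ℝ, (M : ℝ) ^ (-(c₂ * MassartSQ.ell M ζ)) ≤ τ ∧
          τ ≤ (M : ℝ) ^ (-(c₁ * MassartSQ.ell M ζ)) ∧
          ∀ (Ω : Type*) [MeasurableSpace Ω] (P : Measure Ω) [IsProbabilityMeasure P]
            (alg : Ω → MassartSQ.SQAlgorithm M),
            ¬ MassartSQ.Learns P alg (MassartSQ.massartHalfspaces M η ζ) (1 / τ) τ (η - τ) := by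
  refine ⟨10 ^ 10, 1 / 10 ^ 4, 1 / 10 ^ 4, by norm_num, by norm_num, by norm_num, ?_⟩
  intro ζ η M hζ hζη hη hell
  -- Equal constants `c₁ = c₂` determine `τ = M ^ (-l / 10 ^ 4)`.
  refine ⟨_, le_rfl, le_rfl, ?_⟩
  intro Ω _ P _ alg
  obtain ⟨hL, hu, hB, hBL⟩ := MassartSQ.large_of_le_ell hζ (hζη.trans hη) hell
  set l := MassartSQ.ell M ζ with hl
  set L := Real.log M with hLdef
  set B := Real.log (1 / ζ) with hBdef
  set K : ℝ := 1 / 10 ^ 4 * l * L with hKdef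
  have hM0 : (0 : ℝ) < M := by
    rcases Nat.eq_zero_or_pos M with h0 | h0
    · rw [hLdef, h0] at hL
      norm_num at hL
    · exact_mod_cast h0
  have hτ : (M : ℝ) ^ (-(1 / 10 ^ 4 * l)) = Real.exp (-K) := by
    rw [Real.rpow_def_of_pos hM0, ← hLdef, hKdef]
    congr 1
    ring
  have hKL : L ≤ K := by
    have h1 : (10 : ℝ) ^ 10 * L ≤ l * L := mul_le_mul_of_nonneg_right hell (by linarith)
    rw [hKdef]
    norm_num at h1 ⊢
    linarith
  have hKeq : K * (Real.log L ^ 3 * B) = L ^ 2 / 10 ^ 4 := by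
    have : l = L / (Real.log L ^ 3 * B) := rfl
    rw [hKdef, this]
    field_simp
  have hlog2 := Real.log_two_gt_d9
  obtain ⟨k, hkdef⟩ : ∃ k : ℕ, k = ⌈K / Real.log 2⌉₊ := ⟨_, rfl⟩
  have hk1 : K ≤ k * Real.log 2 := by
    rw [← div_le_iff₀ (by linarith), hkdef]
    exact Nat.le_ceil _
  have hk2 : (k : ℝ) ≤ 3 / 2 * K + 1 := by
    have h1 : K / Real.log 2 ≤ 3 / 2 * K := by
      rw [div_le_iff₀ (by linarith)]
      nlinarith
    have h2 := Nat.ceil_lt_add_one (show 0 ≤ K / Real.log 2 by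
      apply div_nonneg <;> linarith)
    rw [← hkdef] at h2
    linarith
  obtain ⟨ρ, hρdef⟩ : ∃ ρ : ℕ, ρ = ⌈√(((5 * k + 8 : ℕ) : ℝ) * B)⌉₊ := ⟨_, rfl⟩
  have hρ1 : √(((5 * k + 8 : ℕ) : ℝ) * B) ≤ ρ := by rw [hρdef]; exact Nat.le_ceil _
  have hρ2 : (ρ : ℝ) ≤ √(((5 * k + 8 : ℕ) : ℝ) * B) + 1 := by
    rw [hρdef]; exact (Nat.ceil_lt_add_one (Real.sqrt_nonneg _)).le
  have hhalf := MassartSQ.half_pow_le_exp_neg hk1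
  have hζexp : ζ = Real.exp (-B) := by
    rw [hBdef, one_div, Real.log_inv, neg_neg, Real.exp_log hζ]
  have hpow : (0 : ℝ) < (1 / 2) ^ k := by positivity
  have hpow2 : ((1 : ℝ) / 2) ^ k * 2 ^ k = 1 := by rw [← mul_pow]; norm_num
  have h2k : (0 : ℝ) < 2 ^ k := by positivity
  rw [hτ]
  -- With `2 ^ (-k) ≤ τ`, this `q` gives `8 / q = 2 ^ (-2k) ≤ τ ^ 2`, and this `m` gives `24 * q =
  -- 192 * 2 ^ (2k) < 256 * 2 ^ (2k) ≤ τ ^ 3 * 2 ^ m`.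
  refine MassartSQ.not_learns_of_params (m := 5 * k + 8) (q := 2 ^ (2 * k + 3)) (ρ := ρ)
    ?_ (by omega) ?_ (hζ.le.trans hζη) hη (Real.exp_pos _) ?_ ?_ ?_ ?_ ?_
    (MassartSQ.window_fits hL hu hB hKL hKeq hk2 hρ2) P alg
  · exact Nat.le_self_pow (by omega) 2
  · have h1 : k < 2 ^ (2 * k) := lt_of_lt_of_le Nat.lt_two_pow_self
      (Nat.pow_le_pow_right (by norm_num) (by omega))
    rw [pow_add]
    omega
  · rw [Real.exp_le_one_iff]
    linarith
  · have h1 := pow_le_pow_left₀ hpow.le hhalf 2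
    refine le_trans (le_of_eq ?_) h1
    push_cast
    rw [pow_add, pow_mul', div_eq_iff (by positivity)]
    calc (8 : ℝ) = ((1 / 2 : ℝ) ^ k * 2 ^ k) ^ 2 * 8 := by rw [hpow2]; norm_num
      _ = _ := by ring
  · have h1 := pow_le_pow_left₀ hpow.le hhalf 3
    have h2 : ((2 : ℝ)) ^ (5 * k + 8) = (2 ^ k) ^ 5 * 256 := by
      rw [pow_add, pow_mul']; norm_num
    have h3 : (((2 : ℕ) ^ (2 * k + 3) : ℕ) : ℝ) = (2 ^ k) ^ 2 * 8 := by
      push_cast; rw [pow_add, pow_mul']; norm_num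
    rw [h2, h3]
    have h4 : ((1 / 2 : ℝ) ^ k) ^ 3 * ((2 ^ k) ^ 5 * 256) = 256 * (2 ^ k) ^ 2 := by
      calc _ = ((1 / 2 : ℝ) ^ k * 2 ^ k) ^ 3 * ((2 ^ k) ^ 2 * 256) := by ring
        _ = _ := by rw [hpow2]; ring
    have h5 := mul_le_mul_of_nonneg_right h1
      (by positivity : (0 : ℝ) ≤ (2 ^ k) ^ 5 * 256)
    rw [h4] at h5
    have : (0 : ℝ) < (2 ^ k) ^ 2 := by positivity
    linarith
  · have h1 : (1 : ℝ) / ((2 ^ (2 * k + 3) : ℕ) : ℝ) ≤ (1 / 2) ^ (2 * k + 3) := by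
      push_cast
      rw [one_div_pow]
    have h2 : ((1 : ℝ) / 2) ^ (2 * k + 3) ≤ Real.exp (-((2 * k + 3 : ℕ) * Real.log 2)) :=
      MassartSQ.half_pow_le_exp_neg le_rfl
    refine h1.trans (h2.trans ?_)
    rw [hζexp]
    apply Real.exp_le_exp.mpr
    push_cast
    nlinarith
  · have hm0 : (0 : ℝ) < ((5 * k + 8 : ℕ) : ℝ) := by positivity
    have h1 : ((5 * k + 8 : ℕ) : ℝ) * B ≤ (ρ : ℝ) ^ 2 := by
      rwa [← Real.sqrt_le_left (by positivity)]
    have h2 : 2 * B ≤ 2 * (ρ : ℝ) ^ 2 / ((5 * k + 8 : ℕ) : ℝ) := by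
      rw [le_div_iff₀ hm0]
      linarith
    have h3 : Real.exp (-(2 * (ρ : ℝ) ^ 2 / ((5 * k + 8 : ℕ) : ℝ))) ≤ ζ * ζ := by
      have : ζ * ζ = Real.exp (-(2 * B)) := by
        rw [hζexp, ← Real.exp_add]
        congr 1
        ring
      rw [this]
      exact Real.exp_le_exp.mpr (by linarith)
    -- The tail is at most `2 * ζ ^ 2`, which is at most `ζ` because `ζ ≤ 1/2`.
    nlinarith
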